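/- Let $\Sigma$ be a finite alphabet and let $F(\Sigma)$ be the free group over $\Sigma$, whose elements are represented by their freely irreducible words over $\Sigma \cup \bar\Sigma$, where $\bar\Sigma = \{\bar a : a \in \Sigma\}$ is a disjoint copy of $\Sigma$ and $\bar a$ stands for the inverse of $a$. A subset $X$ of a semigroup is called a code if, for all integers $m, n \ge 1$ and all $x_1, \dots, x_m, y_1, \dots, y_n \in X$, one has $x_1 x_2 \cdots x_m = y_1 y_2 \cdots y_n$ if and only if $(x_1, \dots, x_m) = (y_1, \dots, y_n)$. The freeness problem over $F(\Sigma)$ is: given a finite subset $X \subseteq F(\Sigma)$, presented as a list of its elements (in any order, possibly with repetitions), each written as a freely irreducible word, decide whether $X$ is a code under the operation of $F(\Sigma)$. For every finite alphabet $\Sigma$, the freeness problem over $F(\Sigma)$ is decidable in polynomial time: there is a (multi-tape) Turing machine, depending on $\Sigma$ only, that decides it in a number of steps bounded by a polynomial in the length of the input. -/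

import Mathlib

namespace Freeness

/-- The product `x₁ x₂ ⋯ xₘ` of the non-empty sequence `(x, l₁, l₂, …)` in a semigroup. -/
def seqProd {S : Type*} [Semigroup S] (x : S) (l : List S) : S :=
  l.foldl (fun a b => a * b) x

/-- A subset `X` of a semigroup is a *code* if for all non-empty sequences `x :: xs` and `y :: ys`
of elements of `X`, the products are equal if and only if the sequences are equal. -/
def IsCode {S : Type*} [Semigroup S] (X : Set S) : Prop :=
  ∀ (x y : S) (xs ys : List S),
    (∀ z ∈ x :: xs, z ∈ X) → (∀ z ∈ y :: ys, z ∈ X) →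
      (seqProd x xs = seqProd y ys ↔ x :: xs = y :: ys)

open Classical in
/-- The predicate `P` on instances `a : α`, presented to the machine as the words `e.encode a`,
is decidable in polynomial time: some (multi-stack) Turing machine outputs the truth value of
`P a` on every input `e.encode a`, in a number of steps bounded by a polynomial in the length
of `e.encode a`. -/
def DecidableInPolyTime {α Γ : Type} (e : Computability.Encoding α Γ) (P : α → Prop) : Prop :=
  Nonempty (Turing.TM2ComputableInPolyTime e.encode Computability.encodeBool
    (fun a => decide (P a)))

/-- The freeness problem over `S` is decidable in polynomial time, when finite sequences of
elements of `S` are encoded by `e`: given a finite subset `X` of `S`, listed in any order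
(and possibly with repetitions), decide whether `X` is a code. -/
def FreenessDecidableInPolyTime (S : Type) [Semigroup S] {Γ : Type}
    (e : Computability.Encoding (List S) Γ) : Prop :=
  DecidableInPolyTime e (fun L : List S => IsCode {x : S | x ∈ L})

/-- Write words one after the other, each one followed by the end marker `none`. -/
def encodeWords {B : Type} (W : List (List B)) : List (Option B) :=
  W.flatMap (fun w => w.map some ++ [none])

/-- Recover the words from their encoding. -/
def decodeWords {B : Type} : List (Option B) → List (List B)
  | [] => []
  | none :: l => [] :: decodeWords l
  | some b :: l =>
    match decodeWords l with
    | [] => [[b]]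
    | w :: W => (b :: w) :: W

theorem decodeWords_encodeWords {B : Type} (W : List (List B)) :
    decodeWords (encodeWords W) = W := by
  induction W with
  | nil => rfl
  | cons w W ih =>
    have h : encodeWords (w :: W) = w.map some ++ none :: encodeWords W := by
      simp [encodeWords]
    rw [h]
    clear h
    induction w with
    | nil => simp [decodeWords, ih]
    | cons b w ihw => simp [decodeWords, ihw]

/-- A finite sequence of elements of the free group over `A` is encoded by the sequence of the
freely irreducible words that represent them, over the alphabet `A × Bool`, where `(a, true)`
stands for the letter `a` and `(a, false)` for its formal inverse. -/
def freeGroupEncoding (A : Type) [DecidableEq A] :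
    Computability.Encoding (List (FreeGroup A)) (Option (A × Bool)) where
  encode L := encodeWords (L.map FreeGroup.toWord)
  decode w := some ((decodeWords w).map FreeGroup.mk)
  decode_encode L := by
    simp [decodeWords_encodeWords, Function.comp_def, FreeGroup.mk_toWord]

end Freeness

namespace Freeness

/-! ### Reduction of words in a free group -/

section Red

variable {A : Type*}

/-! In a group common first factors cancel, so X is a code exactly when no non-empty product of its
elements is 1 and no two products with different first factors coincide (`isCode_iff`). Both
conditions concern one automaton. Its states are the cells of the input; a letter leads to the next
cell, and an end marker leads, by an empty move, to the first cell of any word. The paths from the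
first cell of a word to end markers read exactly the concatenations of words that begin with this
word.

A violation is therefore a path with trivial label from a first cell to an end marker, or a pair of
paths with equal labels in the free group from the first cells of different words to end markers.
Trivial labels are built like Dyck words: a letter, a trivial word, the inverse letter, a trivial
word (`mk_cons_eq_one_split`). Equal labels have a common reduct by the Church–Rosser property, and
in both labels each letter of the reduct comes after a trivial factor (`red_cons_split`). So the
relations needed are the least fixed point `Fact` of rules that involve three cells and their
neighbours, and `isCode_iff_not_violation` expresses the code property through them.

An input of length n admits at most 3n² facts, so 3n² rounds of applying all rules to all triples of
cells produce all of them (`iterate_saturate_eq_facts`).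

To obtain a machine, the procedure is written in a language whose loops run as often as a given
stack is high when they start. A compiled program takes exactly `cost` steps (`stepsIn_code`), and
`cost` is polynomially bounded if no loop is controlled by a tape on which the program pushes
(`Prog.Bounded.cost_le`). That the procedure answers correctly is `sem_mainProg`. -/

theorem red_singleton_split {u : List (A × Bool)} {a : A × Bool} (h : FreeGroup.Red u [a]) :
    ∃ v v', u = v ++ a :: v' ∧ FreeGroup.mk v = 1 ∧ FreeGroup.mk v' = 1 := by
  induction h using Relation.ReflTransGen.head_induction_on with
  | refl => exact ⟨[], [], rfl, rfl, rfl⟩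
  | head hs _ ih =>
    obtain ⟨v, v', e, hv, hv'⟩ := ih
    obtain @⟨L₁, L₂, x, b⟩ := hs
    have key : ∀ M₁ M₂ : List (A × Bool), FreeGroup.mk (M₁ ++ (x, b) :: (x, !b) :: M₂) =
        FreeGroup.mk (M₁ ++ M₂) := fun M₁ M₂ =>
      FreeGroup.Red.exact.2 ⟨_, FreeGroup.Red.Step.not.to_red, FreeGroup.Red.refl⟩
    -- Undoing a reduction step inserts an inverse pair. It lands inside the trivial prefix,
    -- immediately before `a`, or inside the trivial suffix, and the factor that receives it stays
    -- trivial.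
    rcases List.append_eq_append_iff.1 e with ⟨t, rfl, rfl⟩ | ⟨t, rfl, ht⟩
    · exact ⟨L₁ ++ (x, b) :: (x, !b) :: t, v', by simp, by rw [key, hv], hv'⟩
    · cases t with
      | nil =>
        simp only [List.nil_append] at ht
        subst ht
        exact ⟨v ++ [(x, b), (x, !b)], v', by simp,
          by simpa using (key v []).trans (by simpa using hv), hv'⟩
      | cons c t =>
        obtain ⟨rfl, rfl⟩ : a = c ∧ v' = t ++ L₂ := by simpa using ht
        exact ⟨v, t ++ (x, b) :: (x, !b) :: L₂, by simp, hv, by rw [key, hv']⟩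

/-- A reduction to `a :: r` splits into a reduction to `[a]` and one to `r`. The trivial factor
behind `a` reduces to the empty word, so it can be absorbed into the second part. -/
theorem red_cons_split {u r : List (A × Bool)} {a : A × Bool} (h : FreeGroup.Red u (a :: r)) :
    ∃ v v', u = v ++ a :: v' ∧ FreeGroup.mk v = 1 ∧ FreeGroup.Red v' r := by
  obtain ⟨L₁, L₂, rfl, h₁, h₂⟩ := (FreeGroup.Red.to_append_iff (L₁ := [a]) (L₂ := r)).1 h
  obtain ⟨v, v', rfl, hv, hv'⟩ := red_singleton_split h₁
  refine ⟨v, v' ++ L₂, by simp, hv, ?_⟩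
  have h1 : FreeGroup.Red v' [] := by
    obtain ⟨c, hc, hc'⟩ := FreeGroup.Red.exact.1 (hv'.trans FreeGroup.one_eq_mk)
    rwa [FreeGroup.Red.nil_iff.1 hc'] at hc
  simpa using FreeGroup.Red.append_append h1 h₂

/-- A word `(x, b) :: u` is trivial only if `u` reduces to the single inverse letter. This is the
source of the rule `Fact.bracket`. -/
theorem mk_cons_eq_one_split {u : List (A × Bool)} {x : A} {b : Bool}
    (h : FreeGroup.mk ((x, b) :: u) = 1) :
    ∃ v v', u = v ++ (x, !b) :: v' ∧ FreeGroup.mk v = 1 ∧ FreeGroup.mk v' = 1 := by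
  apply red_singleton_split
  rw [← FreeGroup.Red.cons_nil_iff_singleton]
  obtain ⟨c, hc, hc'⟩ := FreeGroup.Red.exact.1 (h.trans FreeGroup.one_eq_mk)
  rwa [FreeGroup.Red.nil_iff.1 hc'] at hc

end Red

/-! ### Codes in a group -/

section Code

variable {G : Type*} [Group G]

theorem seqProd_eq_prod (x : G) (l : List G) : seqProd x l = x * l.prod := by
  induction l generalizing x with
  | nil => simp [seqProd]
  | cons y l ih =>
    have := ih (x * y)
    simp only [seqProd, List.foldl_cons, List.prod_cons] at this ⊢
    rw [this, mul_assoc]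

/-- In a group, `X` is a code if and only if no non-empty product of elements of `X` is trivial
and products starting with different elements of `X` are different. -/
theorem isCode_iff (X : Set G) :
    IsCode X ↔ (¬ ∃ x ∈ X, ∃ xs : List G, (∀ z ∈ xs, z ∈ X) ∧ x * xs.prod = 1) ∧
      ¬ ∃ x ∈ X, ∃ y ∈ X, x ≠ y ∧ ∃ xs ys : List G, (∀ z ∈ xs, z ∈ X) ∧ (∀ z ∈ ys, z ∈ X) ∧
        x * xs.prod = y * ys.prod := by
  constructor
  · intro h
    refine ⟨?_, ?_⟩
    · rintro ⟨x, hx, xs, hxs, e⟩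
      have hm : ∀ z ∈ x :: xs, z ∈ X := by simpa using ⟨hx, hxs⟩
      -- Writing a trivial product twice gives a longer sequence whose product is still trivial.
      have hm' : ∀ z ∈ x :: (xs ++ x :: xs), z ∈ X := by
        intro z hz
        simp only [List.mem_cons, List.mem_append] at hz
        rcases hz with rfl | hz | rfl | hz
        exacts [hx, hxs _ hz, hx, hxs _ hz]
      have := (h _ _ _ _ hm' hm).1 (by
        simp only [seqProd_eq_prod, List.prod_append, List.prod_cons, e, mul_one])
      simpa using congrArg List.length this
    · rintro ⟨x, hx, y, hy, hne, xs, ys, hxs, hys, e⟩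
      have := (h x y xs ys (by simpa using ⟨hx, hxs⟩) (by simpa using ⟨hy, hys⟩)).1
        (by simpa only [seqProd_eq_prod] using e)
      exact hne (List.cons.inj this).1
  · rintro ⟨h₁, h₂⟩
    -- Empty sequences are admitted here, so that equal first elements can be cancelled one after
    -- the other.
    have main : ∀ l l' : List G, (∀ z ∈ l, z ∈ X) → (∀ z ∈ l', z ∈ X) → l.prod = l'.prod →
        l = l' := by
      intro l
      induction l with
      | nil =>
        intro l' _ hl' e
        cases l' with
        | nil => rfl
        | cons y ys =>
          exact (h₁ ⟨y, hl' y (by simp), ys, fun z hz => hl' z (by simp [hz]),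
            by simpa using e.symm⟩).elim
      | cons x xs ih =>
        intro l' hl hl' e
        cases l' with
        | nil =>
          exact (h₁ ⟨x, hl x (by simp), xs, fun z hz => hl z (by simp [hz]),
            by simpa using e⟩).elim
        | cons y ys =>
          have hxs : ∀ z ∈ xs, z ∈ X := fun z hz => hl z (by simp [hz])
          have hys : ∀ z ∈ ys, z ∈ X := fun z hz => hl' z (by simp [hz])
          simp only [List.prod_cons] at e
          by_cases hxy : x = y
          · subst hxy
            rw [ih ys hxs hys (mul_left_cancel e)]
          · exact (h₂ ⟨x, hl x (by simp), y, hl' y (by simp), hxy, xs, ys, hxs, hys, e⟩).elim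
    intro x y xs ys hx hy
    constructor
    · intro e
      simp only [seqProd_eq_prod] at e
      exact main _ _ hx hy (by simpa using e)
    · intro e
      obtain ⟨rfl, rfl⟩ := List.cons.inj e
      rfl

end Code

/-! ### The automaton of an encoded list of words -/

section Automaton

variable {B : Type}

/-- The cell `s` of `w` is the first cell of one of the words encoded by `w`. -/
def IsStart (w : List (Option B)) (s : ℕ) : Prop :=
  s < w.length ∧ ((w.take s).reverse.head? = none ∨ (w.take s).reverse.head? = some none)

/-- The word in front of the first end marker. -/
def firstWord : List (Option B) → List B
  | [] => []
  | none :: _ => []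
  | some b :: l => b :: firstWord l

/-- What remains to be read, from the cell `p` on, of the word to which this cell belongs. -/
def rest (w : List (Option B)) (p : ℕ) : List B :=
  firstWord (w.drop p)

theorem firstWord_map_append (x : List B) (l : List (Option B)) :
    firstWord (x.map some ++ none :: l) = x := by
  induction x with
  | nil => rfl
  | cons b x ih => simpa [firstWord] using ih

theorem rest_of_getElem?_none {w : List (Option B)} {p : ℕ} (h : w[p]? = some none) :
    rest w p = [] := by
  obtain ⟨hp, h'⟩ := List.getElem?_eq_some_iff.1 h
  rw [rest, List.drop_eq_getElem_cons hp, h']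
  rfl

theorem rest_of_getElem?_some {w : List (Option B)} {p : ℕ} {b : B} (h : w[p]? = some (some b)) :
    rest w p = b :: rest w (p + 1) := by
  obtain ⟨hp, h'⟩ := List.getElem?_eq_some_iff.1 h
  rw [rest, List.drop_eq_getElem_cons hp, h']
  rfl

theorem encodeWords_cons (x : List B) (W : List (List B)) :
    encodeWords (x :: W) = x.map some ++ none :: encodeWords W := by
  simp [encodeWords]

theorem isStart_zero {w : List (Option B)} (h : w ≠ []) : IsStart w 0 :=
  ⟨List.length_pos_iff.2 h, by simp⟩

/-- The `getD none` accounts for `s = 0`, where the symbol in front is the end marker of `x`. -/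
theorem head?_reverse_take_append (x : List B) (l : List (Option B)) (s : ℕ) :
    ((((x.map some ++ none :: l).take (x.length + 1 + s))).reverse.head?) =
      some (((l.take s).reverse.head?).getD none) := by
  have : (x.map some ++ none :: l).take (x.length + 1 + s) = x.map some ++ none :: l.take s := by
    rw [List.take_append]
    simp [show x.length + 1 + s - x.length = s + 1 by omega,
      show x.length ≤ x.length + 1 + s by omega]
  rw [this]
  cases h : (l.take s).reverse with
  | nil => simp [List.reverse_eq_nil_iff.1 h]
  | cons c t =>
    simp [h]

theorem isStart_append (x : List B) (l : List (Option B)) (s : ℕ) :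
    IsStart (x.map some ++ none :: l) (x.length + 1 + s) ↔ IsStart l s := by
  rw [IsStart, IsStart, head?_reverse_take_append]
  constructor
  · rintro ⟨h₁, h₂⟩
    refine ⟨by simp at h₁; omega, ?_⟩
    rcases hc : (l.take s).reverse.head? with _ | _ | c <;> simp_all
  · rintro ⟨h₁, h₂⟩
    refine ⟨by simp; omega, ?_⟩
    rcases h₂ with h | h <;> simp [h]

theorem rest_append (x : List B) (l : List (Option B)) (s : ℕ) :
    rest (x.map some ++ none :: l) (x.length + 1 + s) = rest l s := by
  rw [rest, rest, List.drop_append]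
  simp [show x.length + 1 + s - x.length = s + 1 by omega,
    List.drop_eq_nil_of_le (as := x.map some) (i := x.length + 1 + s) (by simp; omega)]

theorem rest_mem_of_isStart {W : List (List B)} {s : ℕ} (h : IsStart (encodeWords W) s) :
    rest (encodeWords W) s ∈ W := by
  induction W generalizing s with
  | nil => simp [IsStart, encodeWords] at h
  | cons x W ih =>
    rw [encodeWords_cons] at h ⊢
    by_cases hs : s = 0
    · subst hs
      simp [rest, firstWord_map_append]
    · by_cases hs' : x.length < s
      · obtain ⟨t, rfl⟩ := Nat.exists_eq_add_of_le (Nat.succ_le_of_lt hs')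
        rw [Nat.succ_eq_add_one, isStart_append] at h
        rw [Nat.succ_eq_add_one, rest_append]
        exact List.mem_cons_of_mem _ (ih h)
      -- For `0 < s ≤ x.length` the symbol in front of the cell is a letter of the first word.
      · exfalso
        obtain ⟨s, rfl⟩ := Nat.exists_eq_succ_of_ne_zero hs
        have hlt : s < x.length := by omega
        have := h.2
        rw [List.take_append_of_le_length (by simpa using hlt), List.take_succ_eq_append_getElem (by simpa using hlt)] at this
        simp at this

theorem exists_isStart_of_mem {W : List (List B)} {x : List B} (h : x ∈ W) :
    ∃ s, IsStart (encodeWords W) s ∧ rest (encodeWords W) s = x := by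
  induction W with
  | nil => simp at h
  | cons y W ih =>
    rw [encodeWords_cons]
    rcases List.mem_cons.1 h with rfl | h
    · exact ⟨0, isStart_zero (by simp), by simp [rest, firstWord_map_append]⟩
    · obtain ⟨s, hs, e⟩ := ih h
      exact ⟨y.length + 1 + s, (isStart_append _ _ _).2 hs, by rw [rest_append, e]⟩

/-- Every word is closed by an end marker, so a letter is never in the last cell. This is the only
property of encodings that the saturation argument needs; there it appears as the hypothesis `hw`.
-/
theorem succ_lt_length_of_getElem?_some {W : List (List B)} {p : ℕ} {b : B}
    (h : (encodeWords W)[p]? = some (some b)) : p + 1 < (encodeWords W).length := by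
  induction W generalizing p with
  | nil => simp [encodeWords] at h
  | cons x W ih =>
    rw [encodeWords_cons] at h ⊢
    by_cases hp : x.length < p
    · obtain ⟨t, rfl⟩ := Nat.exists_eq_add_of_le (Nat.succ_le_of_lt hp)
      rw [List.getElem?_append_right (by simp; omega)] at h
      simp only [List.length_map, show x.length.succ + t - x.length = t + 1 by omega,
        List.getElem?_cons_succ] at h
      have := ih h
      simp
      omega
    · rcases Nat.lt_or_ge p x.length with h' | h'
      · simp
        omega
      · obtain rfl : p = x.length := by omega
        rw [List.getElem?_append_right (by simp)] at h
        simp at h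

end Automaton

/-! ### Facts about pairs of cells -/

/-- The three relations between cells that the decision procedure computes. -/
inductive Mode
  | cancel
  | meet
  | differ
  deriving DecidableEq

instance : Fintype Mode :=
  ⟨{.cancel, .meet, .differ}, fun m => by cases m <;> simp⟩

section Facts

variable {A : Type}

/-- `Path w p u q`: the automaton that reads sequences of words of `w` can move from the cell `p`
to the cell `q` while reading `u`. -/
inductive Path (w : List (Option (A × Bool))) : ℕ → List (A × Bool) → ℕ → Prop
  | nil {p : ℕ} : p < w.length → Path w p [] p
  | eps {p r q : ℕ} {u : List (A × Bool)} :
      w[p]? = some none → IsStart w r → Path w r u q → Path w p u q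
  | letter {p q : ℕ} {a : A × Bool} {u : List (A × Bool)} :
      w[p]? = some (some a) → Path w (p + 1) u q → Path w p (a :: u) q

/-- The relations, as a least fixed point: `cancel` relates cells joined by a path with trivial
label, `meet` relates cells from which two paths with equal labels lead to ends of words, and
`differ` relates cells with different remaining words. -/
inductive Fact (w : List (Option (A × Bool))) : Mode → ℕ → ℕ → Prop
  | refl {p : ℕ} : p < w.length → Fact w .cancel p p
  | eps {p r q : ℕ} : w[p]? = some none → IsStart w r → Fact w .cancel r q → Fact w .cancel p q
  | bracket {p r q : ℕ} {x : A} {b : Bool} : w[p]? = some (some (x, b)) →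
      w[r]? = some (some (x, !b)) → Fact w .cancel (p + 1) r → Fact w .cancel (r + 1) q →
      Fact w .cancel p q
  | ends {p q : ℕ} : w[p]? = some none → w[q]? = some none → Fact w .meet p q
  | left {p r q : ℕ} : Fact w .cancel p r → Fact w .meet r q → Fact w .meet p q
  | right {p r q : ℕ} : Fact w .cancel q r → Fact w .meet p r → Fact w .meet p q
  | both {p q : ℕ} {a : A × Bool} : w[p]? = some (some a) → w[q]? = some (some a) →
      Fact w .meet (p + 1) (q + 1) → Fact w .meet p q
  | differ {p q : ℕ} : p < w.length → q < w.length → w[p]? ≠ w[q]? → Fact w .differ p q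
  | same {p q : ℕ} {a : A × Bool} : w[p]? = some (some a) → w[q]? = some (some a) →
      Fact w .differ (p + 1) (q + 1) → Fact w .differ p q

variable {w : List (Option (A × Bool))}

theorem Path.left_lt {p q : ℕ} {u : List (A × Bool)} (h : Path w p u q) : p < w.length := by
  cases h with
  | nil h => exact h
  | eps h _ _ => exact (List.getElem?_eq_some_iff.1 h).1
  | letter h _ => exact (List.getElem?_eq_some_iff.1 h).1

theorem Path.trans {p q r : ℕ} {u v : List (A × Bool)} (h : Path w p u q) (h' : Path w q v r) :
    Path w p (u ++ v) r := by
  induction h with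
  | nil _ => exact h'
  | eps h₁ h₂ _ ih => exact .eps h₁ h₂ (ih h')
  | letter h₁ _ ih => exact .letter h₁ (ih h')

theorem Path.split {p q : ℕ} {u v v' : List (A × Bool)} {a : A × Bool} (h : Path w p u q)
    (e : u = v ++ a :: v') :
    ∃ r, Path w p v r ∧ w[r]? = some (some a) ∧ Path w (r + 1) v' q := by
  induction h generalizing v with
  | nil _ => simp at e
  | eps h₁ h₂ _ ih =>
    obtain ⟨r, h₃, h₄⟩ := ih e
    exact ⟨r, .eps h₁ h₂ h₃, h₄⟩
  | @letter p q c u h₁ h₂ ih =>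
    cases v with
    | nil =>
      obtain ⟨rfl, rfl⟩ : c = a ∧ u = v' := by simpa using e
      exact ⟨p, .nil (List.getElem?_eq_some_iff.1 h₁).1, h₁, h₂⟩
    | cons d v =>
      obtain ⟨rfl, rfl⟩ : c = d ∧ u = v ++ a :: v' := by simpa using e
      obtain ⟨r, h₃, h₄⟩ := ih rfl
      exact ⟨r, .letter h₁ h₃, h₄⟩

/-- The outer induction is on the length of the label; the inner one, on the path, handles the empty
moves, which do not shorten the label. The first letter read is matched with the inverse letter that
cancels it, and the factors between and behind them are shorter trivial labels. -/
theorem Path.fact_cancel_aux (n : ℕ) : ∀ {p q : ℕ} {u : List (A × Bool)}, u.length ≤ n →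
    Path w p u q → FreeGroup.mk u = 1 → Fact w .cancel p q := by
  induction n with
  | zero =>
    intro p q u hn h e
    induction h with
    | nil h => exact .refl h
    | eps h₁ h₂ _ ih => exact .eps h₁ h₂ (ih hn e)
    | letter h₁ _ _ => simp at hn
  | succ n ihn =>
    intro p q u hn h e
    induction h with
    | nil h => exact .refl h
    | eps h₁ h₂ _ ih => exact .eps h₁ h₂ (ih hn e)
    | @letter p q c u h₁ h₂ _ =>
      obtain ⟨x, b⟩ := c
      obtain ⟨v, v', rfl, hv, hv'⟩ := mk_cons_eq_one_split e
      obtain ⟨r, h₃, h₄, h₅⟩ := h₂.split rfl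
      simp only [List.length_cons, List.length_append] at hn
      exact .bracket h₁ h₄ (ihn (by omega) h₃ hv) (ihn (by omega) h₅ hv')

theorem Path.fact_cancel {p q : ℕ} {u : List (A × Bool)} (h : Path w p u q)
    (e : FreeGroup.mk u = 1) : Fact w .cancel p q :=
  h.fact_cancel_aux _ le_rfl e

/-- Induction on the common reduct. If it is empty, both paths have trivial labels and end at end
markers. Otherwise both paths skip a trivial factor, read the same letter, and continue with labels
that reduce to the tail. -/
theorem fact_meet_of_red (r : List (A × Bool)) : ∀ {p q e e' : ℕ} {u u' : List (A × Bool)},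
    w[e]? = some none → w[e']? = some none → Path w p u e → Path w q u' e' →
    FreeGroup.Red u r → FreeGroup.Red u' r → Fact w .meet p q := by
  induction r with
  | nil =>
    intro p q e e' u u' he he' h h' hu hu'
    have h₁ := h.fact_cancel (FreeGroup.Red.exact.2 ⟨_, hu, FreeGroup.Red.refl⟩)
    have h₂ := h'.fact_cancel (FreeGroup.Red.exact.2 ⟨_, hu', FreeGroup.Red.refl⟩)
    exact .left h₁ (.right h₂ (.ends he he'))
  | cons a r ih =>
    intro p q e e' u u' he he' h h' hu hu'
    obtain ⟨v, v', rfl, hv, hv'⟩ := red_cons_split hu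
    obtain ⟨t, t', rfl, ht, ht'⟩ := red_cons_split hu'
    obtain ⟨p', h₁, h₂, h₃⟩ := h.split rfl
    obtain ⟨q', k₁, k₂, k₃⟩ := h'.split rfl
    exact .left (h₁.fact_cancel hv) (.right (k₁.fact_cancel ht)
      (.both h₂ k₂ (ih he he' h₃ k₃ hv' ht')))

/-- What a fact means. -/
def Holds (w : List (Option (A × Bool))) : Mode → ℕ → ℕ → Prop
  | .cancel, p, q => ∃ u, Path w p u q ∧ FreeGroup.mk u = 1
  | .meet, p, q => ∃ u u' e e', w[e]? = some none ∧ w[e']? = some none ∧ Path w p u e ∧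
      Path w q u' e' ∧ FreeGroup.mk u = FreeGroup.mk u'
  | .differ, p, q => p < w.length ∧ q < w.length ∧ rest w p ≠ rest w q

theorem mk_append_one {u v : List (A × Bool)} (h : FreeGroup.mk u = 1) :
    FreeGroup.mk (u ++ v) = FreeGroup.mk v := by
  rw [← FreeGroup.mul_mk, h, one_mul]

theorem mk_cons_mul (a : A × Bool) (v : List (A × Bool)) :
    FreeGroup.mk (a :: v) = FreeGroup.mk [a] * FreeGroup.mk v := by
  rw [FreeGroup.mul_mk]
  rfl

theorem Fact.holds {m : Mode} {p q : ℕ} (h : Fact w m p q) : Holds w m p q := by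
  induction h with
  | refl h => exact ⟨[], .nil h, rfl⟩
  | eps h₁ h₂ _ ih =>
    obtain ⟨u, h, e⟩ := ih
    exact ⟨u, .eps h₁ h₂ h, e⟩
  | @bracket p r q x b h₁ h₂ _ _ ih₁ ih₂ =>
    obtain ⟨u, hu, eu⟩ := ih₁
    obtain ⟨v, hv, ev⟩ := ih₂
    refine ⟨(x, b) :: (u ++ (x, !b) :: v), .letter h₁ (hu.trans (.letter h₂ hv)), ?_⟩
    rw [mk_cons_mul, mk_append_one eu, ← mk_cons_mul, ← ev]
    exact FreeGroup.Red.exact.2 ⟨_, (FreeGroup.Red.Step.not (L₁ := [])).to_red, FreeGroup.Red.refl⟩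
  | @ends p q h₁ h₂ =>
    exact ⟨[], [], p, q, h₁, h₂, .nil (List.getElem?_eq_some_iff.1 h₁).1,
      .nil (List.getElem?_eq_some_iff.1 h₂).1, rfl⟩
  | left _ _ ih₁ ih₂ =>
    obtain ⟨u, hu, eu⟩ := ih₁
    obtain ⟨v, v', e, e', he, he', hv, hv', ev⟩ := ih₂
    exact ⟨u ++ v, v', e, e', he, he', hu.trans hv, hv', by rw [mk_append_one eu, ev]⟩
  | right _ _ ih₁ ih₂ =>
    obtain ⟨u, hu, eu⟩ := ih₁
    obtain ⟨v, v', e, e', he, he', hv, hv', ev⟩ := ih₂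
    exact ⟨v, u ++ v', e, e', he, he', hv, hu.trans hv', by rw [mk_append_one eu, ev]⟩
  | @both p q a h₁ h₂ _ ih =>
    obtain ⟨v, v', e, e', he, he', hv, hv', ev⟩ := ih
    exact ⟨a :: v, a :: v', e, e', he, he', .letter h₁ hv, .letter h₂ hv',
      by rw [mk_cons_mul, ev, ← mk_cons_mul]⟩
  | @differ p q hp hq h =>
    refine ⟨hp, hq, fun e => h ?_⟩
    rw [List.getElem?_eq_getElem hp, List.getElem?_eq_getElem hq]
    rcases h₁ : w[p] with _ | a <;> rcases h₂ : w[q] with _ | b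
    · rfl
    · rw [rest_of_getElem?_none (by rw [List.getElem?_eq_getElem hp, h₁]),
        rest_of_getElem?_some (by rw [List.getElem?_eq_getElem hq, h₂])] at e
      cases e
    · rw [rest_of_getElem?_none (p := q) (by rw [List.getElem?_eq_getElem hq, h₂]),
        rest_of_getElem?_some (by rw [List.getElem?_eq_getElem hp, h₁])] at e
      cases e
    · rw [rest_of_getElem?_some (p := p) (by rw [List.getElem?_eq_getElem hp, h₁]),
        rest_of_getElem?_some (p := q) (by rw [List.getElem?_eq_getElem hq, h₂])] at e
      rw [(List.cons.inj e).1]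
  | same h₁ h₂ _ ih =>
    refine ⟨(List.getElem?_eq_some_iff.1 h₁).1, (List.getElem?_eq_some_iff.1 h₂).1, ?_⟩
    rw [rest_of_getElem?_some h₁, rest_of_getElem?_some h₂]
    exact fun e => ih.2.2 (List.cons.inj e).2

theorem fact_cancel_iff {p q : ℕ} :
    Fact w .cancel p q ↔ ∃ u, Path w p u q ∧ FreeGroup.mk u = 1 :=
  ⟨fun h => h.holds, fun ⟨_, h, e⟩ => h.fact_cancel e⟩

theorem fact_meet_iff {p q : ℕ} :
    Fact w .meet p q ↔ ∃ u u' e e', w[e]? = some none ∧ w[e']? = some none ∧ Path w p u e ∧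
      Path w q u' e' ∧ FreeGroup.mk u = FreeGroup.mk u' := by
  refine ⟨fun h => h.holds, ?_⟩
  rintro ⟨u, u', e, e', he, he', h, h', eq⟩
  obtain ⟨r, hr, hr'⟩ := FreeGroup.Red.exact.1 eq
  exact fact_meet_of_red r he he' h h' hr hr'

end Facts

/-! ### Paths in the automaton and concatenations of words -/

section Words

variable {A : Type} {W : List (List (A × Bool))}

/-- Two cells with different remaining words either carry different symbols or carry the same
letter; two end markers are excluded because nothing remains behind them. In the case of a letter
both next cells exist, and the comparison moves on to them. -/
theorem fact_differ_iff {p q : ℕ} : Fact (encodeWords W) .differ p q ↔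
    p < (encodeWords W).length ∧ q < (encodeWords W).length ∧
      rest (encodeWords W) p ≠ rest (encodeWords W) q := by
  refine ⟨fun h => h.holds, ?_⟩
  suffices H : ∀ n p q, n = (encodeWords W).length - p → p < (encodeWords W).length →
      q < (encodeWords W).length → rest (encodeWords W) p ≠ rest (encodeWords W) q →
      Fact (encodeWords W) .differ p q from fun ⟨hp, hq, h⟩ => H _ p q rfl hp hq h
  intro n
  induction n with
  | zero => intro p q h₁ h₂; omega
  | succ n ih =>
    intro p q hn hp hq h
    by_cases e : (encodeWords W)[p]? = (encodeWords W)[q]?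
    · rcases h' : (encodeWords W)[p]? with _ | _ | a
      · exact absurd (List.getElem?_eq_none_iff.1 h') (by omega)
      · rw [rest_of_getElem?_none h', rest_of_getElem?_none (e ▸ h')] at h
        exact absurd rfl h
      · have hq' := e ▸ h'
        refine .same h' hq' (ih _ _ (by omega) (succ_lt_length_of_getElem?_some h')
          (succ_lt_length_of_getElem?_some hq') fun e' => h ?_)
        rw [rest_of_getElem?_some h', rest_of_getElem?_some hq', e']
    · exact .differ hp hq e

/-- With the converse `exists_path_words`, this determines the labels of paths to end markers: what
is left of the current word, followed by any words of the list. -/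
theorem Path.exists_words {p e : ℕ} {u : List (A × Bool)} (h : Path (encodeWords W) p u e)
    (he : (encodeWords W)[e]? = some none) :
    ∃ xs : List (List (A × Bool)), (∀ x ∈ xs, x ∈ W) ∧
      u = rest (encodeWords W) p ++ xs.flatten := by
  induction h with
  | nil _ => exact ⟨[], by simp, by simp [rest_of_getElem?_none he]⟩
  | @eps p r q u h₁ h₂ _ ih =>
    obtain ⟨xs, hxs, e⟩ := ih he
    refine ⟨rest (encodeWords W) r :: xs, ?_, by simp [rest_of_getElem?_none h₁, e]⟩
    intro x hx
    rcases List.mem_cons.1 hx with rfl | hx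
    exacts [rest_mem_of_isStart h₂, hxs x hx]
  | letter h₁ _ ih =>
    obtain ⟨xs, hxs, e⟩ := ih he
    exact ⟨xs, hxs, by simp [rest_of_getElem?_some h₁, e]⟩

theorem exists_path_rest {p : ℕ} (hp : p < (encodeWords W).length) :
    ∃ e, (encodeWords W)[e]? = some none ∧
      Path (encodeWords W) p (rest (encodeWords W) p) e := by
  obtain ⟨n, hn⟩ : ∃ n, n = (encodeWords W).length - p := ⟨_, rfl⟩
  induction n generalizing p with
  | zero => omega
  | succ n ih =>
    rcases h' : (encodeWords W)[p]? with _ | _ | a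
    · exact absurd (List.getElem?_eq_none_iff.1 h') (by omega)
    · exact ⟨p, h', by rw [rest_of_getElem?_none h']; exact .nil hp⟩
    · obtain ⟨e, he, h⟩ := ih (succ_lt_length_of_getElem?_some h') (by omega)
      exact ⟨e, he, by rw [rest_of_getElem?_some h']; exact .letter h' h⟩

theorem exists_path_words (xs : List (List (A × Bool))) : ∀ {p : ℕ},
    p < (encodeWords W).length → (∀ x ∈ xs, x ∈ W) →
    ∃ e, (encodeWords W)[e]? = some none ∧
      Path (encodeWords W) p (rest (encodeWords W) p ++ xs.flatten) e := by
  induction xs with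
  | nil =>
    intro p hp _
    simpa using exists_path_rest hp
  | cons x xs ih =>
    intro p hp hxs
    obtain ⟨s, hs, rfl⟩ := exists_isStart_of_mem (hxs x (by simp))
    obtain ⟨e, he, h⟩ := exists_path_rest hp
    obtain ⟨e', he', h'⟩ := ih hs.1 fun x hx => hxs x (by simp [hx])
    exact ⟨e', he', by simpa using h.trans (.eps he hs h')⟩

end Words

/-! ### The code property in terms of facts -/

section Criterion

variable {A : Type}

theorem mk_flatten (xs : List (List (A × Bool))) :
    FreeGroup.mk xs.flatten = (xs.map FreeGroup.mk).prod := by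
  induction xs with
  | nil => rfl
  | cons x xs ih => rw [List.flatten_cons, ← FreeGroup.mul_mk, ih, List.map_cons, List.prod_cons]

/-- The word `w` encodes words that do not form a code. -/
def Violation (w : List (Option (A × Bool))) : Prop :=
  ∃ s < w.length, ∃ e < w.length, IsStart w s ∧ ((w[e]? = some none ∧ Fact w .cancel s e) ∨
    (IsStart w e ∧ Fact w .meet s e ∧ Fact w .differ s e))

theorem isCode_iff_not_violation [DecidableEq A] (L : List (FreeGroup A)) :
    IsCode {x : FreeGroup A | x ∈ L} ↔ ¬ Violation ((freeGroupEncoding A).encode L) := by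
  have hw : (freeGroupEncoding A).encode L = encodeWords (L.map FreeGroup.toWord) := rfl
  rw [hw]
  have toL : ∀ {s}, IsStart (encodeWords (L.map FreeGroup.toWord)) s →
      FreeGroup.mk (rest (encodeWords (L.map FreeGroup.toWord)) s) ∈ L := by
    intro s hs
    obtain ⟨x, hx, e⟩ := List.mem_map.1 (rest_mem_of_isStart hs)
    rwa [← e, FreeGroup.mk_toWord]
  have toWords : ∀ {xs : List (FreeGroup A)}, (∀ z ∈ xs, z ∈ L) →
      ∀ x ∈ xs.map FreeGroup.toWord, x ∈ L.map FreeGroup.toWord := by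
    intro xs h x hx
    obtain ⟨y, hy, rfl⟩ := List.mem_map.1 hx
    exact List.mem_map_of_mem (h y hy)
  have ofWords : ∀ {xs : List (List (A × Bool))}, (∀ x ∈ xs, x ∈ L.map FreeGroup.toWord) →
      ∀ z ∈ xs.map FreeGroup.mk, z ∈ L := by
    intro xs h z hz
    obtain ⟨y, hy, rfl⟩ := List.mem_map.1 hz
    obtain ⟨x, hx, rfl⟩ := List.mem_map.1 (h y hy)
    rwa [FreeGroup.mk_toWord]
  have mkWords : ∀ xs : List (FreeGroup A),
      FreeGroup.mk (xs.map FreeGroup.toWord).flatten = xs.prod := by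
    intro xs
    rw [mk_flatten, List.map_map]
    congr 1
    simp [Function.comp_def, FreeGroup.mk_toWord]
  rw [isCode_iff, ← not_or, not_iff_not]
  constructor
  · rintro (⟨x, hx, xs, hxs, e⟩ | ⟨x, hx, y, hy, hne, xs, ys, hxs, hys, e⟩)
    · obtain ⟨s, hs, hr⟩ := exists_isStart_of_mem (List.mem_map_of_mem (f := FreeGroup.toWord) hx)
      obtain ⟨e', he', h⟩ := exists_path_words (xs.map FreeGroup.toWord) hs.1 (toWords hxs)
      refine ⟨s, hs.1, e', (List.getElem?_eq_some_iff.1 he').1, hs, .inl ⟨he', h.fact_cancel ?_⟩⟩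
      rw [← FreeGroup.mul_mk, mkWords, hr, FreeGroup.mk_toWord, e]
    · obtain ⟨s, hs, hr⟩ := exists_isStart_of_mem (List.mem_map_of_mem (f := FreeGroup.toWord) hx)
      obtain ⟨t, ht, hr'⟩ := exists_isStart_of_mem (List.mem_map_of_mem (f := FreeGroup.toWord) hy)
      obtain ⟨e₁, he₁, h₁⟩ := exists_path_words (xs.map FreeGroup.toWord) hs.1 (toWords hxs)
      obtain ⟨e₂, he₂, h₂⟩ := exists_path_words (ys.map FreeGroup.toWord) ht.1 (toWords hys)
      refine ⟨s, hs.1, t, ht.1, hs, .inr ⟨ht, fact_meet_iff.2 ⟨_, _, _, _, he₁, he₂, h₁, h₂, ?_⟩,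
        fact_differ_iff.2 ⟨hs.1, ht.1, ?_⟩⟩⟩
      · rw [← FreeGroup.mul_mk, ← FreeGroup.mul_mk, mkWords, mkWords, hr, hr', FreeGroup.mk_toWord,
          FreeGroup.mk_toWord, e]
      · rw [hr, hr']
        exact fun h => hne (FreeGroup.toWord_injective h)
  · rintro ⟨s, -, e, -, hs, ⟨he, h⟩ | ⟨ht, hm, hd⟩⟩
    · obtain ⟨u, hu, e₁⟩ := fact_cancel_iff.1 h
      obtain ⟨xs, hxs, rfl⟩ := hu.exists_words he
      refine .inl ⟨_, toL hs, _, ofWords hxs, ?_⟩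
      rw [← mk_flatten, FreeGroup.mul_mk, e₁]
    · obtain ⟨u, u', e₁, e₂, he₁, he₂, h₁, h₂, eq⟩ := fact_meet_iff.1 hm
      obtain ⟨xs, hxs, rfl⟩ := h₁.exists_words he₁
      obtain ⟨ys, hys, rfl⟩ := h₂.exists_words he₂
      refine .inr ⟨_, toL hs, _, toL ht, ?_, _, _, ofWords hxs, ofWords hys, ?_⟩
      -- Here the irreducibility of the input words matters: both remaining words are values of
      -- `FreeGroup.toWord`, so they coincide as soon as they represent the same element.
      · intro h
        apply (fact_differ_iff.1 hd).2.2
        obtain ⟨x, hx, ex⟩ := List.mem_map.1 (rest_mem_of_isStart hs)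
        obtain ⟨y, hy, ey⟩ := List.mem_map.1 (rest_mem_of_isStart ht)
        rw [← ex, ← ey, FreeGroup.mk_toWord, FreeGroup.mk_toWord] at h
        rw [← ex, ← ey, h]
      · rw [← mk_flatten, ← mk_flatten, FreeGroup.mul_mk, FreeGroup.mul_mk, eq]

end Criterion

/-! ### Programs over stacks with a finite register, and their compilation to Turing machines -/

section Steps

variable {C : Type*}

/-- `n` steps of the transition function `f` lead from `c` to `c'`. -/
def StepsIn (f : C → Option C) (n : ℕ) (c c' : C) : Prop :=
  (flip bind f)^[n] (some c) = some c'

theorem StepsIn.single {f : C → Option C} {c c' : C} (h : f c = some c') : StepsIn f 1 c c' := h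

theorem StepsIn.trans {f : C → Option C} {m n : ℕ} {c c' c'' : C} (h : StepsIn f m c c')
    (h' : StepsIn f n c' c'') : StepsIn f (m + n) c c'' := by
  rw [StepsIn, add_comm, Function.iterate_add_apply, h, h']

end Steps

section Programs

variable {τ : Type} (Γ : τ → Type) (σ : Type)

/-- Programs that work on pairs of stacks, one pair for each tape `k : τ`, and on a register. -/
inductive Prog
  | load (f : σ → σ)
  | peek (k : τ) (b : Bool) (f : σ → Option (Γ k) → σ)
  | push (k : τ) (b : Bool) (f : σ → Γ k)
  | pop (k : τ) (b : Bool)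
  | move (k : τ) (b : Bool)
  | modify (k : τ) (b : Bool) (f : σ → Γ k → Γ k)
  | seq (p q : Prog)
  | loop (k : τ) (b : Bool) (p : Prog)

/-- The memory of a program: the register and the stacks. -/
@[ext]
structure Store where
  reg : σ
  stk : ∀ x : τ × Bool, List (Γ x.1)

variable {Γ σ}

namespace Prog

section Semantics

variable [DecidableEq τ]

/-- Move the top of the stack `(k, b)` to the stack `(k, !b)`. -/
def moveStk (k : τ) (b : Bool) (s : Store Γ σ) : Store Γ σ :=
  match s.stk (k, b) with
  | [] => s
  | x :: l => ⟨s.reg, Function.update (Function.update s.stk (k, b) l) (k, !b)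
      (x :: s.stk (k, !b))⟩

/-- The effect of a program. The body of a loop is repeated as many times as the stack given by the
loop has elements at the start. -/
def sem : Prog Γ σ → Store Γ σ → Store Γ σ
  | load f, s => ⟨f s.reg, s.stk⟩
  | peek k b f, s => ⟨f s.reg (s.stk (k, b)).head?, s.stk⟩
  | push k b f, s => ⟨s.reg, Function.update s.stk (k, b) (f s.reg :: s.stk (k, b))⟩
  | pop k b, s => ⟨s.reg, Function.update s.stk (k, b) (s.stk (k, b)).tail⟩
  | move k b, s => moveStk k b s
  | modify k b f, s => ⟨s.reg, Function.update s.stk (k, b)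
      ((s.stk (k, b)).modifyHead (f s.reg))⟩
  | seq p q, s => sem q (sem p s)
  | loop k b p, s => (sem p)^[(s.stk (k, b)).length] s

/-- The number of steps of the compiled program. -/
def cost : Prog Γ σ → Store Γ σ → ℕ
  | seq p q, s => cost p s + cost q (sem p s)
  | loop k b p, s => 2 * (s.stk (k, b)).length + 3 +
      ∑ j ∈ Finset.range (s.stk (k, b)).length, (1 + cost p ((sem p)^[j] s))
  | _, _ => 1

end Semantics

/-- The nesting depth of loops. -/
def depth : Prog Γ σ → ℕ
  | seq p q => max (depth p) (depth q)
  | loop _ _ p => depth p + 1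
  | _ => 0

/-! #### Polynomial bounds -/

/-- The program does not push on the tapes in `S`, and its loops are controlled by such tapes. -/
def Bounded (S : τ → Prop) : Prog Γ σ → Prop
  | push k _ _ => ¬ S k
  | seq p q => Bounded S p ∧ Bounded S q
  | loop k _ p => S k ∧ Bounded S p
  | _ => True

/-- A bound of the cost in terms of the size of the tapes that control the loops. -/
noncomputable def bound : Prog Γ σ → Polynomial ℕ
  | seq p q => bound p + bound q
  | loop _ _ p => 2 * Polynomial.X + 3 + Polynomial.X * (1 + bound p)
  | _ => 1

/-- The number of elements on a tape. -/
def size (s : Store Γ σ) (k : τ) : ℕ :=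
  (s.stk (k, false)).length + (s.stk (k, true)).length

variable [DecidableEq τ]

omit [DecidableEq τ] in
theorem length_le_size (s : Store Γ σ) (k : τ) (b : Bool) :
    (s.stk (k, b)).length ≤ size s k := by
  cases b <;> simp [size]

theorem size_update_le {s : Store Γ σ} {k : τ} {b : Bool} {l : List (Γ k)} {r : σ}
    (h : l.length ≤ (s.stk (k, b)).length) (j : τ) :
    size ⟨r, Function.update s.stk (k, b) l⟩ j ≤ size s j := by
  by_cases hj : j = k
  · subst hj
    cases b <;> simp_all [size]
  · simp [size, Function.update, hj]

theorem update_apply_not (S : ∀ x : τ × Bool, List (Γ x.1)) (k : τ) (b : Bool) (l : List (Γ k)) :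
    Function.update S (k, b) l (k, !b) = S (k, !b) :=
  Function.update_of_ne (by simp) _ _

theorem moveStk_of_nil {s : Store Γ σ} {k : τ} {b : Bool} (h : s.stk (k, b) = []) :
    moveStk k b s = s := by
  rw [moveStk, h]

theorem moveStk_of_cons {s : Store Γ σ} {k : τ} {b : Bool} {x : Γ k} {l : List (Γ k)}
    (h : s.stk (k, b) = x :: l) : moveStk k b s = ⟨s.reg, Function.update
      (Function.update s.stk (k, b) l) (k, !b) (x :: s.stk (k, !b))⟩ := by
  rw [moveStk, h]

theorem moveStk_not_of_cons {s : Store Γ σ} {k : τ} {b : Bool} {x : Γ k} {l : List (Γ k)}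
    (h : s.stk (k, !b) = x :: l) : moveStk k (!b) s = ⟨s.reg, Function.update
      (Function.update s.stk (k, !b) l) (k, b) (x :: s.stk (k, b))⟩ := by
  rw [moveStk_of_cons h]
  -- Only for a concrete `b` does `!!b` compute to `b`.
  cases b <;> rfl

theorem stk_moveStk_self (k : τ) (b : Bool) (s : Store Γ σ) :
    (moveStk k b s).stk (k, b) = (s.stk (k, b)).tail := by
  rcases h : s.stk (k, b) with _ | ⟨x, l⟩
  · rw [moveStk_of_nil h, h, List.tail_nil]
  · rw [moveStk_of_cons h]
    simp

theorem stk_moveStk_not (k : τ) {b b' : Bool} (hb : b' = !b) (s : Store Γ σ) :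
    (moveStk k b s).stk (k, b') = (s.stk (k, b)).head?.toList ++ s.stk (k, b') := by
  subst hb
  rcases h : s.stk (k, b) with _ | ⟨x, l⟩
  · rw [moveStk_of_nil h]
    simp
  · rw [moveStk_of_cons h]
    simp

theorem stk_moveStk_of_ne {k j : τ} (b b' : Bool) (s : Store Γ σ) (hj : j ≠ k) :
    (moveStk k b s).stk (j, b') = s.stk (j, b') := by
  rcases h : s.stk (k, b) with _ | ⟨x, l⟩
  · rw [moveStk_of_nil h]
  · rw [moveStk_of_cons h]
    simp [hj]

theorem reg_moveStk (k : τ) (b : Bool) (s : Store Γ σ) : (moveStk k b s).reg = s.reg := by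
  rw [moveStk]
  split <;> rfl

omit [DecidableEq τ] in
theorem size_eq_add_not (s : Store Γ σ) (k : τ) (b : Bool) :
    size s k = (s.stk (k, b)).length + (s.stk (k, !b)).length := by
  cases b
  · rfl
  · exact add_comm _ _

theorem size_moveStk (s : Store Γ σ) (k : τ) (b : Bool) (j : τ) :
    size (moveStk k b s) j = size s j := by
  by_cases hj : j = k
  · subst hj
    rw [size_eq_add_not _ j b, size_eq_add_not s j b, stk_moveStk_self, stk_moveStk_not j rfl]
    rcases s.stk (j, b) with _ | ⟨x, l⟩
    · simp
    · simp
      omega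
  · rw [size, size, stk_moveStk_of_ne _ _ _ hj, stk_moveStk_of_ne _ _ _ hj]

/-- On an empty stack the first move does nothing, and the move back could then shift an element
that had never been moved. -/
theorem moveStk_not_moveStk {k : τ} {b : Bool} {s : Store Γ σ} (h : s.stk (k, b) ≠ []) :
    moveStk k (!b) (moveStk k b s) = s := by
  obtain ⟨x, l, hs⟩ := List.exists_cons_of_ne_nil h
  have h₁ : (moveStk k b s).stk (k, !b) = x :: s.stk (k, !b) := by
    rw [stk_moveStk_not k rfl, hs]
    rfl
  ext1
  · rw [reg_moveStk, reg_moveStk]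
  · funext ⟨j, b'⟩
    by_cases hj : j = k
    · subst hj
      rcases Bool.eq_or_eq_not b' b with rfl | rfl
      · rw [stk_moveStk_not j (b := !b') (by simp), h₁, stk_moveStk_self, hs]
        rfl
      · rw [stk_moveStk_self, h₁, List.tail_cons]
    · rw [stk_moveStk_of_ne _ _ _ hj, stk_moveStk_of_ne _ _ _ hj]

theorem size_push_of_ne {s : Store Γ σ} {k j : τ} {b : Bool} {l : List (Γ k)} {r : σ}
    (h : j ≠ k) : size ⟨r, Function.update s.stk (k, b) l⟩ j = size s j := by
  simp [size, Function.update, h]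

/-- Only `push` enlarges a tape: `size` counts both stacks of a pair, so moves preserve it. -/
theorem Bounded.size_le {S : τ → Prop} {p : Prog Γ σ} (h : Bounded S p) (s : Store Γ σ) {k : τ}
    (hk : S k) : size (sem p s) k ≤ size s k := by
  induction p generalizing s with
  | load f => exact le_rfl
  | peek j b f => exact le_rfl
  | push j b f =>
    have hne : k ≠ j := fun e => h (e ▸ hk)
    exact (size_push_of_ne hne).le
  | pop j b => exact size_update_le (by simp) k
  | move j b => exact (size_moveStk s j b k).le
  | modify j b f => exact size_update_le (by simp) k
  | seq p q ihp ihq => exact (ihq h.2 _).trans (ihp h.1 _)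
  | loop j b p ih =>
    have : ∀ n s, size ((sem p)^[n] s) k ≤ size s k := by
      intro n
      induction n with
      | zero => exact fun s => le_rfl
      | succ n ihn => exact fun s => (ihn _).trans (ih h.2 _)
    exact this _ _

theorem Bounded.size_iterate_le {S : τ → Prop} {p : Prog Γ σ} (h : Bounded S p) (n : ℕ)
    (s : Store Γ σ) {k : τ} (hk : S k) : size ((sem p)^[n] s) k ≤ size s k := by
  induction n generalizing s with
  | zero => exact le_rfl
  | succ n ihn => exact (ihn _).trans (h.size_le _ hk)

/-- A controlling tape never grows, so each loop makes at most `N` rounds, and every round starts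
from a store that satisfies the same size bound. -/
theorem Bounded.cost_le {S : τ → Prop} {p : Prog Γ σ} (h : Bounded S p) {N : ℕ} (s : Store Γ σ)
    (hs : ∀ k, S k → size s k ≤ N) : cost p s ≤ (bound p).eval N := by
  induction p generalizing s with
  | load | peek | push | pop | move | modify => simp [cost, bound]
  | seq p q ihp ihq =>
    simp only [cost, bound, Polynomial.eval_add]
    exact add_le_add (ihp h.1 _ hs) (ihq h.2 _ fun k hk => (h.1.size_le _ hk).trans (hs k hk))
  | loop k b p ih =>
    have hlen := (length_le_size s k b).trans (hs k h.1)
    have hsum : ∑ j ∈ Finset.range (s.stk (k, b)).length, (1 + cost p ((sem p)^[j] s)) ≤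
        N * (1 + (bound p).eval N) := by
      refine (Finset.sum_le_card_nsmul _ _ (1 + (bound p).eval N) fun j _ => ?_).trans ?_
      · exact Nat.add_le_add_left
          (ih h.2 _ fun i hi => (h.2.size_iterate_le j s hi).trans (hs i hi)) 1
      · rw [Finset.card_range, smul_eq_mul]
        exact Nat.mul_le_mul_right _ hlen
    simp only [cost, bound, Polynomial.eval_add, Polynomial.eval_mul, Polynomial.eval_X,
      Polynomial.eval_one, Polynomial.eval_ofNat]
    omega

/-! #### Compilation -/

section Compile

open Turing

variable (Γ) in
/-- The stack alphabets of the compiled program: its stacks are those of the program, a stack used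
to copy counters (`none`), and a counter for each level of nesting of loops. -/
@[reducible]
def MΓ (D : ℕ) : (τ × Bool) ⊕ Option (Fin D) → Type
  | .inl x => Γ x.1
  | .inr _ => Unit

variable (Γ σ) in
/-- The register of the compiled program, with room for stack elements and a flag. -/
abbrev MReg : Type := σ × (∀ k, Option (Γ k)) × Bool

/-- The stages of a loop. -/
inductive LoopStage
  | unwind
  | rewind
  | test

instance : Fintype LoopStage :=
  ⟨⟨{.unwind, .rewind, .test}, by simp⟩, fun l => by cases l <;> simp⟩

/-- The labels of the compiled program. -/
@[reducible]
def Lbl : Prog Γ σ → Type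
  | seq p q => Lbl p ⊕ Lbl q
  | loop _ _ p => LoopStage ⊕ Lbl p
  | _ => Unit

/-- The labels of a compiled program form a finite type. -/
@[reducible]
def fintypeLbl : (p : Prog Γ σ) → Fintype (Lbl p)
  | load _ | peek _ _ _ | push _ _ _ | pop _ _ | move _ _ | modify _ _ _ =>
    inferInstanceAs (Fintype Unit)
  | seq p q => @instFintypeSum _ _ (fintypeLbl p) (fintypeLbl q)
  | loop _ _ p => @instFintypeSum _ _ inferInstance (fintypeLbl p)

/-- The first label of a compiled program. -/
def entry : (p : Prog Γ σ) → Lbl p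
  | load _ | peek _ _ _ | push _ _ _ | pop _ _ | move _ _ | modify _ _ _ => ()
  | seq p _ => .inl (entry p)
  | loop _ _ _ => .inl .unwind

/-- Reset the auxiliary parts of the register. -/
def clr (v : MReg Γ σ) : MReg Γ σ := (v.1, fun _ => none, false)

/-- Store a stack element in the register. -/
def keep (k : τ) (v : MReg Γ σ) (x : Option (Γ k)) : MReg Γ σ :=
  (v.1, Function.update v.2.1 k x, v.2.2)

variable [∀ k, Inhabited (Γ k)] {D : ℕ} [NeZero D]

/-- The code of a program that continues at the label `next`. -/
def code : (p : Prog Γ σ) → {Λ : Type} → (Lbl p → Λ) → Λ → Lbl p →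
    TM2.Stmt (MΓ Γ D) Λ (MReg Γ σ)
  | load f, _, _, next, _ => .load (fun v => (f v.1, v.2)) (.goto fun _ => next)
  | peek k b f, _, _, next, _ =>
    .peek (.inl (k, b)) (fun v x => (f v.1 x, v.2)) (.goto fun _ => next)
  | push k b f, _, _, next, _ => .push (.inl (k, b)) (fun v => f v.1) (.goto fun _ => next)
  | pop k b, _, _, next, _ => .pop (.inl (k, b)) (fun v _ => v) (.goto fun _ => next)
  | move k b, _, _, next, _ =>
    .pop (.inl (k, b)) (keep k) (.branch (fun v => (v.2.1 k).isSome)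
      -- The default is never written, because the branch is taken only if an element was popped.
      (.push (.inl (k, !b)) (fun v => (v.2.1 k).getD default) (.load clr (.goto fun _ => next)))
      (.load clr (.goto fun _ => next)))
  | modify k b f, _, _, next, _ =>
    .pop (.inl (k, b)) (keep k) (.branch (fun v => (v.2.1 k).isSome)
      (.push (.inl (k, b)) (fun v => f v.1 ((v.2.1 k).getD default))
        (.load clr (.goto fun _ => next)))
      (.load clr (.goto fun _ => next)))
  | seq p q, _, emb, _, .inl l => code p (emb ∘ .inl) (emb (.inr (entry q))) l
  | seq _ q, _, emb, next, .inr l => code q (emb ∘ .inr) next l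
  -- The number of rounds must be fixed in advance, since the body may alter the controlling stack.
  -- `unwind` empties this stack onto its partner while counting on the copy stack; `rewind`
  -- restores it and transfers the count to the counter of this nesting level; `test` spends the
  -- counter, one unit per round.
  | loop k b _, _, emb, _, .inl .unwind =>
    .pop (.inl (k, b)) (keep k) (.branch (fun v => (v.2.1 k).isSome)
      (.push (.inl (k, !b)) (fun v => (v.2.1 k).getD default) (.push (.inr none) (fun _ => ())
        (.load clr (.goto fun _ => emb (.inl .unwind)))))
      (.load clr (.goto fun _ => emb (.inl .rewind))))
  | loop k b p, _, emb, _, .inl .rewind =>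
    .pop (.inr none) (fun v x => (v.1, v.2.1, x.isSome)) (.branch (fun v => v.2.2)
      (.pop (.inl (k, !b)) (keep k) (.push (.inl (k, b)) (fun v => (v.2.1 k).getD default)
        (.push (.inr (some (Fin.ofNat D (depth p)))) (fun _ => ())
          (.load clr (.goto fun _ => emb (.inl .rewind))))))
      (.load clr (.goto fun _ => emb (.inl .test))))
  | loop _ _ p, _, emb, next, .inl .test =>
    .pop (.inr (some (Fin.ofNat D (depth p)))) (fun v x => (v.1, v.2.1, x.isSome))
      (.branch (fun v => v.2.2)
        (.load clr (.goto fun _ => emb (.inr (entry p))))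
        (.load clr (.goto fun _ => next)))
  | loop _ _ p, _, emb, _, .inr l => code p (emb ∘ .inr) (emb (.inl .test)) l

/-- The stacks of the compiled program. -/
def mstk (s : Store Γ σ) (t : ℕ) (c : Fin D → ℕ) : ∀ x, List (MΓ Γ D x)
  | .inl x => s.stk x
  | .inr none => List.replicate t ()
  | .inr (some i) => List.replicate (c i) ()

/-- A configuration of the compiled program. -/
def cfg {Λ : Type} (l : Λ) (s : Store Γ σ) (t : ℕ) (c : Fin D → ℕ) :
    TM2.Cfg (MΓ Γ D) Λ (MReg Γ σ) :=
  ⟨some l, (s.reg, fun _ => none, false), mstk s t c⟩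

omit [∀ k, Inhabited (Γ k)] [NeZero D] in
theorem update_mstk_inl (s : Store Γ σ) (t : ℕ) (c : Fin D → ℕ) (x : τ × Bool)
    (l : List (Γ x.1)) : Function.update (mstk s t c) (.inl x) l =
      mstk ⟨s.reg, Function.update s.stk x l⟩ t c := by
  funext y
  rcases y with y | _ | i
  · by_cases h : y = x
    · subst h
      simp [mstk]
    · rw [Function.update_of_ne (by simpa using h)]
      simp [mstk, h]
  · rfl
  · rfl

omit [∀ k, Inhabited (Γ k)] [NeZero D] in
theorem update_mstk_none (s : Store Γ σ) (t t' : ℕ) (c : Fin D → ℕ) :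
    Function.update (mstk s t c) (.inr none) (List.replicate t' ()) = mstk s t' c := by
  funext y
  rcases y with y | _ | i
  · rfl
  · simp [mstk]
  · rfl

omit [∀ k, Inhabited (Γ k)] [NeZero D] in
theorem update_mstk_some (s : Store Γ σ) (t : ℕ) (c : Fin D → ℕ) (i : Fin D) (n : ℕ) :
    Function.update (mstk s t c) (.inr (some i)) (List.replicate n ()) =
      mstk s t (Function.update c i n) := by
  funext y
  rcases y with y | _ | j
  · rfl
  · rfl
  · by_cases h : j = i
    · subst h
      simp [mstk]
    · rw [Function.update_of_ne (by simpa using h)]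
      simp [mstk, h]

variable {Λ : Type} {M : Λ → TM2.Stmt (MΓ Γ D) Λ (MReg Γ σ)}

omit [DecidableEq τ] [∀ k, Inhabited (Γ k)] [NeZero D] in
theorem clr_eq (r : σ) (f : ∀ k, Option (Γ k)) (b : Bool) :
    clr (r, f, b) = (r, fun _ => none, false) := rfl

theorem stepsIn_move {l next : Λ} {k : τ} {b : Bool}
    (h : M l = code (move k b) (fun _ => l) next ()) (s : Store Γ σ) (t : ℕ) (c : Fin D → ℕ) :
    StepsIn (TM2.step M) 1 (cfg l s t c) (cfg next (moveStk k b s) t c) := by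
  refine .single ?_
  rw [cfg, TM2.step, h]
  simp only [code, TM2.stepAux, keep]
  rcases hs : s.stk (k, b) with _ | ⟨x, l⟩
  · rw [moveStk_of_nil hs]
    simp only [mstk, hs, List.head?_nil, List.tail_nil, Function.update_self, Option.isSome_none,
      cond_false, clr_eq]
    rw [update_mstk_inl, ← hs, Function.update_eq_self]
    rfl
  · rw [moveStk_of_cons hs]
    simp only [mstk, hs, List.head?_cons, List.tail_cons, Function.update_self, Option.isSome_some,
      cond_true, clr_eq, Option.getD_some]
    rw [update_mstk_inl, update_mstk_inl]
    simp only [mstk, update_apply_not]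
    rfl

theorem stepsIn_modify {l next : Λ} {k : τ} {b : Bool} {f : σ → Γ k → Γ k}
    (h : M l = code (modify k b f) (fun _ => l) next ()) (s : Store Γ σ) (t : ℕ)
    (c : Fin D → ℕ) :
    StepsIn (TM2.step M) 1 (cfg l s t c) (cfg next (sem (modify k b f) s) t c) := by
  refine .single ?_
  rw [cfg, TM2.step, h]
  simp only [code, TM2.stepAux, keep, sem]
  rcases hs : s.stk (k, b) with _ | ⟨x, l⟩
  · simp only [mstk, hs, List.head?_nil, List.tail_nil, Function.update_self, Option.isSome_none,
      cond_false, clr_eq, List.modifyHead_nil]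
    rw [update_mstk_inl]
    rfl
  · simp only [mstk, hs, List.head?_cons, List.tail_cons, Function.update_self, Option.isSome_some,
      cond_true, clr_eq, Option.getD_some, List.modifyHead_cons, Function.update_idem]
    rw [update_mstk_inl]
    rfl

/-! ### The three stages of a compiled loop -/

section Loop

variable {k : τ} {b : Bool} {p : Prog Γ σ} {emb : Lbl (loop k b p) → Λ} {next : Λ}

theorem stepsIn_unwind (h : M (emb (.inl .unwind)) = code (loop k b p) emb next (.inl .unwind))
    (c : Fin D → ℕ) (n : ℕ) : ∀ (s : Store Γ σ) (t : ℕ), (s.stk (k, b)).length = n →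
    StepsIn (TM2.step M) (n + 1) (cfg (emb (.inl .unwind)) s t c)
      (cfg (emb (.inl .rewind)) ((moveStk k b)^[n] s) (t + n) c) := by
  induction n with
  | zero =>
    intro s t hn
    have hs : s.stk (k, b) = [] := List.length_eq_zero_iff.1 hn
    refine .single ?_
    rw [cfg, TM2.step, h]
    simp only [code, TM2.stepAux, keep, mstk, hs, List.head?_nil, List.tail_nil,
      Function.update_self, Option.isSome_none, cond_false, clr_eq]
    rw [update_mstk_inl, ← hs, Function.update_eq_self]
    rfl
  | succ n ih =>
    intro s t hn
    obtain ⟨x, l, hs⟩ := List.exists_cons_of_length_eq_add_one hn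
    have h₁ : StepsIn (TM2.step M) 1 (cfg (emb (.inl .unwind)) s t c)
        (cfg (emb (.inl .unwind)) (moveStk k b s) (t + 1) c) := by
      refine .single ?_
      rw [cfg, TM2.step, h, moveStk_of_cons hs]
      simp only [code, TM2.stepAux, keep, mstk, hs, List.head?_cons, List.tail_cons,
        Function.update_self, Option.isSome_some, cond_true, clr_eq, Option.getD_some]
      rw [update_mstk_inl, update_mstk_inl]
      simp only [mstk, update_apply_not]
      rw [← List.replicate_succ, update_mstk_none]
      rfl
    have h₂ := ih (moveStk k b s) (t + 1) (by rw [stk_moveStk_self, hs]; simpa [hs] using hn)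
    rw [show t + (n + 1) = t + 1 + n by omega, show n + 1 + 1 = 1 + (n + 1) by omega]
    exact h₁.trans h₂

theorem stepsIn_rewind (h : M (emb (.inl .rewind)) = code (loop k b p) emb next (.inl .rewind))
    (c : Fin D → ℕ) (s : Store Γ σ) (n : ℕ) : ∀ m, n ≤ (s.stk (k, b)).length →
    c (Fin.ofNat D (depth p)) = m →
    StepsIn (TM2.step M) (n + 1) (cfg (emb (.inl .rewind)) ((moveStk k b)^[n] s) n c)
      (cfg (emb (.inl .test)) s 0 (Function.update c (Fin.ofNat D (depth p)) (m + n))) := by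
  induction n generalizing c with
  | zero =>
    intro m _ hm
    refine .single ?_
    rw [cfg, TM2.step, h]
    simp only [code, TM2.stepAux, keep, mstk, List.replicate_zero, List.head?_nil, List.tail_nil,
      Option.isSome_none, cond_false, clr_eq, Function.iterate_zero, id]
    rw [← List.replicate_zero (a := ()), update_mstk_none, add_zero, ← hm, Function.update_eq_self]
    rfl
  | succ n ih =>
    intro m hn hm
    have hlen : ∀ j, (((moveStk k b)^[j] s).stk (k, b)).length = (s.stk (k, b)).length - j := by
      intro j
      induction j with
      | zero => rfl
      | succ j ihj =>
        rw [Function.iterate_succ_apply', stk_moveStk_self, List.length_tail, ihj]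
        omega
    have hne : ((moveStk k b)^[n] s).stk (k, b) ≠ [] := by
      rw [← List.length_pos_iff, hlen]
      omega
    have hback := moveStk_not_moveStk hne
    obtain ⟨x, l, hs⟩ := List.exists_cons_of_ne_nil hne
    have hs' : (moveStk k b ((moveStk k b)^[n] s)).stk (k, !b) =
        x :: ((moveStk k b)^[n] s).stk (k, !b) := by
      rw [stk_moveStk_not k rfl, hs]
      rfl
    have h₁ : StepsIn (TM2.step M) 1
        (cfg (emb (.inl .rewind)) ((moveStk k b)^[n + 1] s) (n + 1) c)
        (cfg (emb (.inl .rewind)) ((moveStk k b)^[n] s) n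
          (Function.update c (Fin.ofNat D (depth p)) (m + 1))) := by
      refine .single ?_
      rw [Function.iterate_succ_apply']
      generalize (moveStk k b)^[n] s = s₁ at *
      generalize hs₂ : moveStk k b s₁ = s₂ at *
      rw [← hback, moveStk_not_of_cons hs', cfg, TM2.step, h]
      simp only [code, TM2.stepAux, keep, mstk, Function.update_self, List.replicate_succ,
        List.head?_cons, List.tail_cons, Option.isSome_some, cond_true, clr_eq]
      rw [update_mstk_none]
      simp only [mstk, hs', List.head?_cons, List.tail_cons, Option.getD_some]
      rw [update_mstk_inl, update_mstk_inl]
      simp only [mstk]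
      rw [Function.update_of_ne (a := (k, b)) (by simp), hm, ← List.replicate_succ,
        update_mstk_some]
      rfl
    have h₂ := ih (Function.update c (Fin.ofNat D (depth p)) (m + 1)) (m + 1) (by omega) (by simp)
    rw [Function.update_idem] at h₂
    rw [show m + (n + 1) = m + 1 + n by omega, show n + 1 + 1 = 1 + (n + 1) by omega]
    exact h₁.trans h₂

theorem stepsIn_test (h : M (emb (.inl .test)) = code (loop k b p) emb next (.inl .test))
    {c : Fin D → ℕ} (hc : c (Fin.ofNat D (depth p)) = 0)
    (hp : ∀ (s : Store Γ σ) (m : ℕ), StepsIn (TM2.step M) (cost p s)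
      (cfg (emb (.inr (entry p))) s 0 (Function.update c (Fin.ofNat D (depth p)) m))
      (cfg (emb (.inl .test)) (sem p s) 0 (Function.update c (Fin.ofNat D (depth p)) m)))
    (n : ℕ) : ∀ s : Store Γ σ, StepsIn (TM2.step M)
      (1 + ∑ j ∈ Finset.range n, (1 + cost p ((sem p)^[j] s)))
      (cfg (emb (.inl .test)) s 0 (Function.update c (Fin.ofNat D (depth p)) n))
      (cfg next ((sem p)^[n] s) 0 c) := by
  induction n with
  | zero =>
    intro s
    refine .single ?_
    rw [cfg, TM2.step, h]
    simp only [code, TM2.stepAux, mstk, Function.update_self, List.replicate_zero, List.head?_nil,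
      List.tail_nil, Option.isSome_none, cond_false, clr_eq, Function.iterate_zero, id]
    rw [← List.replicate_zero (a := ()), update_mstk_some, Function.update_idem, ← hc,
      Function.update_eq_self]
    rfl
  | succ n ih =>
    intro s
    have h₁ : StepsIn (TM2.step M) 1
        (cfg (emb (.inl .test)) s 0 (Function.update c (Fin.ofNat D (depth p)) (n + 1)))
        (cfg (emb (.inr (entry p))) s 0 (Function.update c (Fin.ofNat D (depth p)) n)) := by
      refine .single ?_
      rw [cfg, TM2.step, h]
      simp only [code, TM2.stepAux, mstk, Function.update_self, List.replicate_succ,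
        List.head?_cons, List.tail_cons, Option.isSome_some, cond_true, clr_eq]
      rw [update_mstk_some, Function.update_idem]
      rfl
    have h₂ := (h₁.trans (hp s n)).trans (ih (sem p s))
    rw [Finset.sum_range_succ', Function.iterate_succ_apply]
    convert h₂ using 1
    simp only [Function.iterate_succ_apply, Function.iterate_zero, id]
    omega

end Loop

/-- The counter of a loop has the depth of the body as its index, and the body uses only counters of
smaller index. So the induction hypothesis applies to the body whatever the value of that counter,
and it leaves the counter as it was. -/
theorem stepsIn_code (p : Prog Γ σ) : ∀ {emb : Lbl p → Λ} {next : Λ},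
    (∀ l, M (emb l) = code p emb next l) → depth p ≤ D → ∀ (s : Store Γ σ) (c : Fin D → ℕ),
    (∀ i, i.val < depth p → c i = 0) →
    StepsIn (TM2.step M) (cost p s) (cfg (emb (entry p)) s 0 c) (cfg next (sem p s) 0 c) := by
  induction p with
  | load f =>
    intro emb next h _ s c _
    refine .single ?_
    rw [cfg, TM2.step, h]
    rfl
  | peek k b f =>
    intro emb next h _ s c _
    refine .single ?_
    rw [cfg, TM2.step, h]
    rfl
  | push k b f =>
    intro emb next h _ s c _
    refine .single ?_
    rw [cfg, TM2.step, h]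
    simp only [code, TM2.stepAux, sem]
    rw [update_mstk_inl]
    rfl
  | pop k b =>
    intro emb next h _ s c _
    refine .single ?_
    rw [cfg, TM2.step, h]
    simp only [code, TM2.stepAux, sem]
    rw [update_mstk_inl]
    rfl
  | move k b =>
    intro emb next h _ s c _
    exact stepsIn_move (h _) s 0 c
  | modify k b f =>
    intro emb next h _ s c _
    exact stepsIn_modify (h _) s 0 c
  | seq p q ihp ihq =>
    intro emb next h hd s c hc
    simp only [depth] at hd hc
    have h₁ := ihp (emb := emb ∘ .inl) (fun l => h (.inl l)) (by omega) s c
      fun i hi => hc i (by omega)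
    have h₂ := ihq (emb := emb ∘ .inr) (fun l => h (.inr l)) (by omega) (sem p s) c
      fun i hi => hc i (by omega)
    exact h₁.trans h₂
  | loop k b p ih =>
    intro emb next h hd s c hc
    simp only [depth] at hd hc
    -- No wrap-around occurs, because `depth p + 1 ≤ D`.
    have hval : (Fin.ofNat D (depth p)).val = depth p := Nat.mod_eq_of_lt hd
    have hc0 := hc (Fin.ofNat D (depth p)) (by omega)
    have h₁ := stepsIn_unwind (h (.inl .unwind)) c _ s 0 rfl
    have h₂ := stepsIn_rewind (h (.inl .rewind)) c s _ 0 le_rfl hc0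
    have h₃ := stepsIn_test (h (.inl .test)) hc0 (fun s' m =>
      ih (emb := emb ∘ .inr) (fun l => h (.inr l)) (by omega) s'
        (Function.update c (Fin.ofNat D (depth p)) m) (fun i hi => by
          rw [Function.update_of_ne (by rintro rfl; omega)]
          exact hc i (by omega))) (s.stk (k, b)).length s
    rw [zero_add] at h₁ h₂
    -- With `n` rounds, unwinding and rewinding take `n + 1` steps each, and the tests take one step
    -- per round plus a last one; this is the summand `2 * n + 3` of the cost together with the sum.
    have h₄ := (h₁.trans h₂).trans h₃
    rw [cost, sem]
    convert h₄ using 1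
    · omega
    · rfl

/-- All stacks are empty, except for `(k, b)`. -/
def oneStack (k : τ) (b : Bool) (l : List (Γ k)) : ∀ x : τ × Bool, List (Γ x.1) :=
  Function.update (fun _ => []) (k, b) l

/-- A program that transforms every input into the corresponding output in polynomial time yields a
Turing machine that does so. -/
theorem nonempty_computableInPolyTime [Fintype τ] [∀ k, Fintype (Γ k)] [Fintype σ] {α β : Type}
    {inp out : τ} (e : α → List (Γ inp)) (e' : β → List (Γ out)) (f : α → β) (p : Prog Γ σ)
    (r : σ) (time : Polynomial ℕ)
    (hp : ∀ a, cost p ⟨r, oneStack inp true (e a)⟩ ≤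
        time.eval (e a).length ∧
      (sem p ⟨r, oneStack inp true (e a)⟩).stk =
        oneStack out false (e' (f a))) :
    Nonempty (TM2ComputableInPolyTime e e' f) := by
  classical
  let _ := fintypeLbl p
  let M : Option (Lbl p) → TM2.Stmt (MΓ Γ (depth p + 1)) (Option (Lbl p)) (MReg Γ σ) := fun l =>
    match l with
    -- A final configuration must carry the initial register, so the register is reset before
    -- halting. This accounts for the extra step in `time + 1`.
    | none => .load (fun _ => (r, fun _ => none, false)) .halt
    | some l => code p some none l
  let tm : FinTM2 :=
    { K := (τ × Bool) ⊕ Option (Fin (depth p + 1))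
      k₀ := .inl (inp, true)
      k₁ := .inl (out, false)
      Γ := MΓ Γ (depth p + 1)
      Λ := Option (Lbl p)
      main := some (entry p)
      σ := MReg Γ σ
      initialState := (r, fun _ => none, false)
      Γk₀Fin := inferInstanceAs (Fintype (Γ inp))
      m := M }
  refine ⟨{ tm := tm, inputAlphabet := Equiv.refl _, outputAlphabet := Equiv.refl _,
            time := time + 1, outputsFun := fun a => ?_ }⟩
  have hsim := stepsIn_code (M := M) p (emb := some) (next := none) (fun _ => rfl) (Nat.le_succ _)
    ⟨r, oneStack inp true (e a)⟩ (fun _ => 0) (fun _ _ => rfl)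
  have hlast : StepsIn (TM2.step M) 1 (cfg none
      (sem p ⟨r, oneStack inp true (e a)⟩) 0 fun _ => 0)
      (haltList tm (e' (f a))) := by
    refine .single ?_
    rw [cfg, TM2.step]
    simp only [M, TM2.stepAux, haltList]
    congr 2
    funext x
    rcases x with ⟨k, b⟩ | _ | i
    · rw [mstk, (hp a).2]
      by_cases h : (k, b) = (out, false)
      · obtain ⟨rfl, rfl⟩ := Prod.mk.inj h
        rw [oneStack, Function.update_self, dif_pos rfl]
        rfl
      · rw [oneStack, Function.update_of_ne h, dif_neg fun h' => h (Sum.inl.inj h')]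
    · rfl
    · rfl
  have hinit : initList tm (e a) =
      cfg (some (entry p)) ⟨r, oneStack inp true (e a)⟩ 0 fun _ => 0 := by
    simp only [initList, cfg]
    congr 1
    funext x
    rcases x with ⟨k, b⟩ | _ | i
    · change _ = oneStack inp true (e a) (k, b)
      by_cases h : (k, b) = (inp, true)
      · obtain ⟨rfl, rfl⟩ := Prod.mk.inj h
        rw [oneStack, Function.update_self, dif_pos rfl]
        rfl
      · rw [oneStack, Function.update_of_ne h, dif_neg fun h' => h (Sum.inl.inj h')]
    · rfl
    · rfl
  have h := hsim.trans hlast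
  rw [← hinit] at h
  refine ⟨⟨cost p ⟨r, oneStack inp true (e a)⟩ + 1, ?_⟩, ?_⟩
  · rw [show List.map (Equiv.refl (Γ inp)).invFun (e a) = e a from List.map_id _,
      show List.map (Equiv.refl (Γ out)).invFun (e' (f a)) = e' (f a) from List.map_id _]
    exact h
  · simpa using (hp a).1

end Compile

end Prog

end Programs

/-! ### Tapes with a head position -/

section Tapes

variable {τ : Type} {Γ : τ → Type} {σ : Type}

namespace Prog

/-- The part of a tape to the left (`false`) or to the right (`true`) of its head. -/
def zipper {α : Type} (l : List α) (i : ℕ) : Bool → List α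
  | false => (l.take i).reverse
  | true => l.drop i

/-- The store whose tape `k` contains `c k` and has its head in front of the cell `pos k`. -/
def tapes (r : σ) (c : ∀ k, List (Γ k)) (pos : τ → ℕ) : Store Γ σ :=
  ⟨r, fun x => zipper (c x.1) (pos x.1) x.2⟩

theorem size_tapes (r : σ) (c : ∀ k, List (Γ k)) (pos : τ → ℕ) (k : τ) :
    size (tapes r c pos) k = (c k).length := by
  simp only [size, tapes, zipper, List.length_reverse, List.length_take, List.length_drop]
  omega

variable [DecidableEq τ] (r : σ) (c : ∀ k, List (Γ k)) (pos : τ → ℕ)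

theorem sem_seq (p q : Prog Γ σ) (s : Store Γ σ) : sem (seq p q) s = sem q (sem p s) := rfl

/-- No bound on the position is needed: at the end of the tape the move does nothing, and a position
beyond the end describes the same stacks as the end itself. -/
theorem sem_move_true (k : τ) : sem (move k true) (tapes r c pos) =
    tapes r c (Function.update pos k (pos k + 1)) := by
  ext1
  · exact reg_moveStk _ _ _
  · funext ⟨j, b⟩
    by_cases hj : j = k
    · subst hj
      cases b
      · rw [sem, stk_moveStk_not j (b := true) (b' := false) rfl]
        simp only [tapes, zipper, List.take_add_one, List.head?_drop, Function.update_self,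
          List.reverse_append]
        cases (c j)[pos j]? <;> rfl
      · rw [sem, stk_moveStk_self]
        simp [tapes, zipper]
    · rw [sem, stk_moveStk_of_ne _ _ _ hj]
      simp [tapes, hj]

/-- The bound is needed: from a position beyond the end the head really steps left from the end,
while `pos k - 1` may still denote the end. -/
theorem sem_move_false {k : τ} (h : pos k ≤ (c k).length) : sem (move k false) (tapes r c pos) =
    tapes r c (Function.update pos k (pos k - 1)) := by
  ext1
  · exact reg_moveStk _ _ _
  · funext ⟨j, b⟩
    by_cases hj : j = k
    · subst hj
      cases b
      · rw [sem, stk_moveStk_self]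
        simp only [tapes, zipper, List.tail_reverse, List.dropLast_eq_take, List.length_take,
          List.take_take, Function.update_self]
        congr 2
        omega
      · rw [sem, stk_moveStk_not j (b := false) (b' := true) rfl]
        rcases hp : pos j with _ | i
        · simp [tapes, zipper, hp]
        · rw [hp] at h
          have h' : i < (c j).length := h
          simp only [tapes, zipper, hp, Function.update_self, Nat.add_sub_cancel]
          rw [List.take_add_one, List.getElem?_eq_getElem h', List.drop_eq_getElem_cons h',
            List.reverse_append]
          rfl
    · rw [sem, stk_moveStk_of_ne _ _ _ hj]
      simp [tapes, hj]

theorem sem_peek_true (k : τ) (f : σ → Option (Γ k) → σ) :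
    sem (peek k true f) (tapes r c pos) = tapes (f r (c k)[pos k]?) c pos := by
  simp [sem, tapes, zipper, List.head?_drop]

theorem sem_peek_false (k : τ) (f : σ → Option (Γ k) → σ) :
    sem (peek k false f) (tapes r c pos) =
      tapes (f r ((c k).take (pos k)).reverse.head?) c pos := rfl

theorem sem_modify_true (k : τ) (f : σ → Γ k → Γ k) : sem (modify k true f) (tapes r c pos) =
    tapes r (Function.update c k ((c k).modify (pos k) (f r))) pos := by
  ext1
  · rfl
  · funext ⟨j, b⟩
    by_cases hj : j = k
    · subst hj
      cases b
      · simp [sem, tapes, zipper, List.take_modify, List.modify_eq_self]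
      · simp only [sem, tapes, zipper, Function.update_self]
        rw [List.drop_modify_of_ge _ _ _ _ le_rfl, Nat.sub_self]
        rfl
    · simp [sem, tapes, hj]

theorem sem_push_false {k : τ} (f : σ → Γ k) (h : pos k = (c k).length) :
    sem (push k false f) (tapes r c pos) =
      tapes r (Function.update c k (c k ++ [f r])) (Function.update pos k (pos k + 1)) := by
  ext1
  · rfl
  · funext ⟨j, b⟩
    by_cases hj : j = k
    · subst hj
      cases b <;> simp [sem, tapes, zipper, h, List.take_of_length_le]
    · simp [sem, tapes, hj]

theorem sem_loop_false (k : τ) (p : Prog Γ σ) : sem (loop k false p) (tapes r c pos) =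
    (sem p)^[min (pos k) (c k).length] (tapes r c pos) := by
  simp [sem, tapes, zipper]

theorem sem_loop_true (k : τ) (p : Prog Γ σ) : sem (loop k true p) (tapes r c pos) =
    (sem p)^[(c k).length - pos k] (tapes r c pos) := by
  simp [sem, tapes, zipper]

theorem iterate_sem_move_true (k : τ) (n : ℕ) : (sem (move k true))^[n] (tapes r c pos) =
    tapes r c (Function.update pos k (pos k + n)) := by
  induction n with
  | zero => simp
  | succ n ih =>
    rw [Function.iterate_succ_apply', ih, sem_move_true]
    simp [add_assoc]

omit [DecidableEq τ] in
theorem tapes_eq_of_min {pos' : τ → ℕ}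
    (h : ∀ k, min (pos k) (c k).length = min (pos' k) (c k).length) :
    tapes r c pos = tapes r c pos' := by
  have take_min : ∀ {α : Type} (l : List α) (i : ℕ), l.take (min i l.length) = l.take i := by
    intro α l i
    rcases le_total i l.length with hi | hi
    · rw [min_eq_left hi]
    · rw [min_eq_right hi, List.take_length, List.take_of_length_le hi]
  have drop_min : ∀ {α : Type} (l : List α) (i : ℕ), l.drop (min i l.length) = l.drop i := by
    intro α l i
    rcases le_total i l.length with hi | hi
    · rw [min_eq_left hi]
    · rw [min_eq_right hi, List.drop_length, List.drop_of_length_le hi]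
  ext1
  · rfl
  · funext ⟨k, b⟩
    cases b
    · simp only [tapes, zipper]
      rw [← take_min, h k, take_min]
    · simp only [tapes, zipper]
      rw [← drop_min, h k, drop_min]

theorem sem_rewind (k : τ) : sem (loop k false (move k false)) (tapes r c pos) =
    tapes r c (Function.update pos k 0) := by
  have main : ∀ n pos, pos k ≤ (c k).length → pos k = n →
      (sem (move k false))^[n] (tapes r c pos) = tapes r c (Function.update pos k 0) := by
    intro n
    induction n with
    | zero =>
      intro pos _ h
      conv_rhs => rw [← h, Function.update_eq_self]
      rfl
    | succ n ih =>
      intro pos hle h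
      rw [Function.iterate_succ_apply, sem_move_false _ _ _ hle,
        ih _ (by simp; omega) (by simp [h]), Function.update_idem]
  -- A position beyond the end is first replaced by the end, where moves to the left are tracked
  -- correctly.
  rw [sem_loop_false, tapes_eq_of_min r c pos
    (pos' := Function.update pos k (min (pos k) (c k).length)), main _ _ (by simp) (by simp),
    Function.update_idem]
  intro j
  by_cases hj : j = k
  · subst hj
    simp
  · simp [hj]

theorem iterate_sem_pop (k : τ) (b : Bool) (n : ℕ) (s : Store Γ σ) :
    (sem (pop k b))^[n] s = ⟨s.reg, Function.update s.stk (k, b) ((s.stk (k, b)).drop n)⟩ := by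
  induction n with
  | zero => simp
  | succ n ih =>
    rw [Function.iterate_succ_apply', ih, sem]
    simp

theorem sem_clear {k : τ} (h : (c k).length ≤ pos k) :
    sem (loop k false (pop k false)) (tapes r c pos) = tapes r (Function.update c k []) pos := by
  rw [sem_loop_false, iterate_sem_pop]
  ext1
  · rfl
  · funext ⟨j, b⟩
    by_cases hj : j = k
    · subst hj
      cases b <;> simp [tapes, zipper, h]
    · simp [tapes, hj]

end Prog

end Tapes

/-! ### Saturation of the table of facts -/

section Iteration

variable {α : Type*}

/-- Apply `f 0`, `f 1`, …, `f (n - 1)` in this order. -/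
def iter (f : ℕ → α → α) : ℕ → α → α
  | 0, a => a
  | n + 1, a => f n (iter f n a)

theorem iter_induction {P : α → Prop} {f : ℕ → α → α} {n : ℕ}
    (h : ∀ i < n, ∀ a, P a → P (f i a)) {a : α} (ha : P a) : P (iter f n a) := by
  induction n with
  | zero => exact ha
  | succ n ih => exact h n n.lt_succ_self _ (ih fun i hi => h i (hi.trans n.lt_succ_self))

variable {β : Type*}

theorem subset_iter {f : ℕ → Set β → Set β} (h : ∀ i S, S ⊆ f i S) (n : ℕ) (S : Set β) :
    S ⊆ iter f n S := by
  induction n with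
  | zero => exact subset_rfl
  | succ n ih => exact ih.trans (h n _)

/-- All the maps are increasing, so each intermediate set lies between `S` and the final set, which
is again `S`. -/
theorem eq_of_iter_eq {f : ℕ → Set β → Set β} (h : ∀ i S, S ⊆ f i S) {n : ℕ} {S : Set β}
    (hS : iter f n S = S) {i : ℕ} (hi : i < n) : f i S = S := by
  induction n with
  | zero => omega
  | succ n ih =>
    have h₁ : iter f n S = S := ((h n _).trans hS.subset).antisymm (subset_iter h n S)
    rcases Nat.lt_succ_iff_lt_or_eq.1 hi with hi | rfl
    · exact ih h₁ hi
    · rwa [iter, h₁] at hS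

/-- As long as the set changes, each application adds an element, which can happen at most `B.ncard`
times. -/
theorem iterate_isFixedPt_of_card_le {f : Set β → Set β} (h : ∀ S, S ⊆ f S) {B : Set β}
    (hB : B.Finite) (hf : ∀ S ⊆ B, f S ⊆ B) {S : Set β} (hS : S ⊆ B) {N : ℕ} (hN : B.ncard ≤ N) :
    f (f^[N] S) = f^[N] S := by
  have hsub : ∀ k, f^[k] S ⊆ B := by
    intro k
    induction k with
    | zero => exact hS
    | succ k ih =>
      rw [Function.iterate_succ_apply']
      exact hf _ ih
  have key : ∀ k, f (f^[k] S) = f^[k] S ∨ k < (f (f^[k] S)).ncard := by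
    intro k
    induction k with
    | zero =>
      by_cases e : f S = S
      · exact .inl e
      · refine .inr ?_
        have hlt : S ⊂ f S := (h S).ssubset_of_ne (Ne.symm e)
        exact Nat.zero_lt_of_lt (Set.ncard_lt_ncard hlt (hB.subset (hf S hS)))
    | succ k ih =>
      rw [Function.iterate_succ_apply']
      rcases ih with ih | ih
      · exact .inl (by rw [ih, ih])
      · by_cases e : f (f (f^[k] S)) = f (f^[k] S)
        · exact .inl e
        · refine .inr (lt_of_le_of_lt ih ?_)
          exact Set.ncard_lt_ncard ((h _).ssubset_of_ne (Ne.symm e))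
            (hB.subset (hf _ (hf _ (hsub k))))
  rcases key N with h' | h'
  · exact h'
  · have := Set.ncard_le_ncard (hf _ (hsub N)) hB
    omega

end Iteration

/-! ### The table of facts and one round of the rules -/

section Saturation

variable {A : Type}

/-- An entry of the table tells which facts hold for a pair of cells. -/
abbrev Entry : Type := Mode → Bool

/-- The register of the decision procedure. -/
@[ext]
structure Reg (A : Type) where
  sym : Fin 4 → Option (Option (A × Bool))
  entry : Fin 6 → Entry
  acc : Bool

namespace Reg

/-- Store a symbol. -/
def setSym (v : Reg A) (i : Fin 4) (a : Option (Option (A × Bool))) : Reg A :=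
  { v with sym := Function.update v.sym i a }

/-- Store an entry of the table. -/
def setEntry (v : Reg A) (i : Fin 6) (a : Entry) : Reg A :=
  { v with entry := Function.update v.entry i a }

/-- The facts that follow from the contents of the register. The symbols are those at the cells
`p`, `q`, `r` and in front of `r`, and the entries those at `(p, r)`, `(q, r)`, `(r, q)`,
`(p + 1, r)`, `(p + 1, q + 1)` and `(r + 1, q)`. -/
def Derives (v : Reg A) : Mode → Prop
  | .cancel => (v.sym 0 = some none ∧ (v.sym 3 = none ∨ v.sym 3 = some none) ∧
      v.entry 2 .cancel = true) ∨
      ∃ x b, v.sym 0 = some (some (x, b)) ∧ v.sym 2 = some (some (x, !b)) ∧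
        v.entry 3 .cancel = true ∧ v.entry 5 .cancel = true
  | .meet => (v.sym 0 = some none ∧ v.sym 1 = some none) ∨
      (v.entry 0 .cancel = true ∧ v.entry 2 .meet = true) ∨
      (v.entry 1 .cancel = true ∧ v.entry 0 .meet = true) ∨
      ∃ a, v.sym 0 = some (some a) ∧ v.sym 1 = some (some a) ∧ v.entry 4 .meet = true
  | .differ => v.sym 0 ≠ v.sym 1 ∨
      ∃ a, v.sym 0 = some (some a) ∧ v.sym 1 = some (some a) ∧ v.entry 4 .differ = true

end Reg

open Classical in
/-- The table of the facts in `S`, for the pairs of numbers below `n`, row by row. -/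
noncomputable def table (n : ℕ) (S : Set (Mode × ℕ × ℕ)) : List Entry :=
  (List.range (n * n)).map fun x m => decide ((m, x / n, x % n) ∈ S)

/-- What is read from the table at row `a` and column `b`. -/
noncomputable def lookup (n : ℕ) (S : Set (Mode × ℕ × ℕ)) (a b : ℕ) : Entry :=
  ((table n S)[a * n + b]?).getD fun _ => false

theorem length_table (n : ℕ) (S : Set (Mode × ℕ × ℕ)) : (table n S).length = n * n := by
  simp [table]

theorem mul_add_lt {n a b : ℕ} (ha : a < n) (hb : b < n) : a * n + b < n * n := by
  calc a * n + b < a * n + n := by omega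
    _ = (a + 1) * n := by ring
    _ ≤ n * n := Nat.mul_le_mul_right n ha

/-- Only the column needs a bound. A row `a ≥ n` lies behind the end of the table and is read as
false, in accordance with `hS`, whereas a column `b ≥ n` would run into a later row. -/
theorem lookup_eq_true_iff {n : ℕ} {S : Set (Mode × ℕ × ℕ)} {a b : ℕ} {m : Mode} (hb : b < n)
    (hS : ∀ t ∈ S, t.2.1 < n) : lookup n S a b m = true ↔ (m, a, b) ∈ S := by
  by_cases ha : a < n
  · have h := mul_add_lt ha hb
    rw [lookup, table, List.getElem?_map, List.getElem?_range h]
    have h₁ : (a * n + b) / n = a := by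
      rw [mul_comm, Nat.mul_add_div (by omega), Nat.div_eq_of_lt hb, add_zero]
    have h₂ : (a * n + b) % n = b := by
      rw [mul_comm, Nat.mul_add_mod, Nat.mod_eq_of_lt hb]
    simp [h₁, h₂]
  · have h : (table n S)[a * n + b]? = none := by
      rw [List.getElem?_eq_none_iff, length_table]
      exact (Nat.mul_le_mul_right n (not_lt.1 ha)).trans (Nat.le_add_right _ _)
    rw [lookup, h]
    simpa using fun h => ha (hS _ h)

/-- The register after the inspection of the cells `i`, `j` and `l`. -/
noncomputable def gathered (w : List (Option (A × Bool))) (S : Set (Mode × ℕ × ℕ)) (i j l : ℕ)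
    (v : Reg A) : Reg A :=
  (((((((((v.setSym 0 w[i]?).setSym 1 w[j]?).setSym 2 w[l]?).setSym 3
    (w.take l).reverse.head?).setEntry 0 (lookup w.length S i l)).setEntry 1
    (lookup w.length S j l)).setEntry 2 (lookup w.length S l j)).setEntry 3
    (lookup w.length S (i + 1) l)).setEntry 4 (lookup w.length S (i + 1) (j + 1))).setEntry 5
    (lookup w.length S (l + 1) j)

/-- Every symbol and entry that `Reg.Derives` consults is overwritten by `gathered`. Hence the
choice of the register in `extend` is immaterial. -/
theorem derives_gathered (w : List (Option (A × Bool))) (S : Set (Mode × ℕ × ℕ)) (i j l : ℕ)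
    (v v' : Reg A) : (gathered w S i j l v).Derives = (gathered w S i j l v').Derives := by
  funext m
  cases m <;> simp [Reg.Derives, gathered, Reg.setSym, Reg.setEntry, Function.update]

/-- Add the facts that follow for the pair of cells `i` and `j` from an inspection of the cells
`i`, `j` and `l`. -/
def extend (w : List (Option (A × Bool))) (i j l : ℕ) (S : Set (Mode × ℕ × ℕ)) :
    Set (Mode × ℕ × ℕ) :=
  {t | t ∈ S ∨ t.2 = (i, j) ∧ ∃ v : Reg A, (gathered w S i j l v).Derives t.1} ∪
    {(.cancel, i, i)}

/-- Add the facts that follow from an inspection of all triples of cells. -/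
def saturate (w : List (Option (A × Bool))) (S : Set (Mode × ℕ × ℕ)) : Set (Mode × ℕ × ℕ) :=
  iter (fun i => iter (fun j => iter (fun l => extend w i j l) w.length) w.length) w.length S

/-- The set of all facts. -/
def facts (w : List (Option (A × Bool))) : Set (Mode × ℕ × ℕ) :=
  {t | Fact w t.1 t.2.1 t.2.2}

variable {w : List (Option (A × Bool))}

theorem subset_extend (i j l : ℕ) (S : Set (Mode × ℕ × ℕ)) : S ⊆ extend w i j l S :=
  fun _ h => .inl (.inl h)

theorem subset_saturate (S : Set (Mode × ℕ × ℕ)) : S ⊆ saturate w S :=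
  subset_iter (fun _ => subset_iter (fun _ => subset_iter (fun _ => subset_extend _ _ _) _) _) _ S

theorem Path.right_lt {p q : ℕ} {u : List (A × Bool)} (h : Path w p u q) : q < w.length := by
  induction h with
  | nil h => exact h
  | eps _ _ _ ih => exact ih
  | letter _ _ ih => exact ih

theorem Fact.lt {m : Mode} {p q : ℕ} (h : Fact w m p q) : p < w.length ∧ q < w.length := by
  have := h.holds
  cases m with
  | cancel =>
    obtain ⟨u, hu, -⟩ := this
    exact ⟨hu.left_lt, hu.right_lt⟩
  | meet =>
    obtain ⟨u, u', e, e', -, -, h, h', -⟩ := this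
    exact ⟨h.left_lt, h'.left_lt⟩
  | differ => exact ⟨this.1, this.2.1⟩

theorem finite_facts : (facts w).Finite := by
  refine (Set.finite_univ.prod ((Set.finite_lt_nat w.length).prod
    (Set.finite_lt_nat w.length))).subset fun t ht => ?_
  exact ⟨trivial, Fact.lt ht⟩

theorem ncard_facts_le : (facts w).ncard ≤ 3 * (w.length * w.length) := by
  classical
  have : facts w ⊆ ((Finset.univ ×ˢ (Finset.range w.length ×ˢ Finset.range w.length) :
      Finset (Mode × ℕ × ℕ)) : Set (Mode × ℕ × ℕ)) := by
    intro t ht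
    simpa using Fact.lt ht
  refine (Set.ncard_le_ncard this (Finset.finite_toSet _)).trans ?_
  rw [Set.ncard_coe_finset]
  simp only [Finset.card_product, Finset.card_range]
  rfl

/-! ### Saturation yields exactly the set of facts -/

section Closure

variable {S : Set (Mode × ℕ × ℕ)} {i j l : ℕ}

theorem lt_of_subset_facts (hS : S ⊆ facts w) : ∀ t ∈ S, t.2.1 < w.length :=
  fun _ ht => (Fact.lt (hS ht)).1

theorem derives_gathered_cancel (hS : S ⊆ facts w) (hj : j < w.length) (hl : l < w.length)
    (v : Reg A) : (gathered w S i j l v).Derives .cancel ↔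
      (w[i]? = some none ∧ IsStart w l ∧ (Mode.cancel, l, j) ∈ S) ∨
      ∃ x b, w[i]? = some (some (x, b)) ∧ w[l]? = some (some (x, !b)) ∧
        (Mode.cancel, i + 1, l) ∈ S ∧ (Mode.cancel, l + 1, j) ∈ S := by
  have h := lt_of_subset_facts hS
  simp only [Reg.Derives, gathered, Reg.setSym, Reg.setEntry, Function.update]
  simp only [Fin.isValue, Fin.reduceEq, dite_false, dite_true, lookup_eq_true_iff hj h,
    lookup_eq_true_iff hl h, IsStart, hl, true_and]

/-- The entry at `(i + 1, j + 1)` could be misread if `j` were the last cell. It is used only when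
cell `j` holds a letter, and then `hw` puts `j + 1` inside the table. -/
theorem derives_gathered_meet (hS : S ⊆ facts w)
    (hw : ∀ p a, w[p]? = some (some a) → p + 1 < w.length) (hj : j < w.length) (hl : l < w.length)
    (v : Reg A) : (gathered w S i j l v).Derives .meet ↔
      (w[i]? = some none ∧ w[j]? = some none) ∨
      ((Mode.cancel, i, l) ∈ S ∧ (Mode.meet, l, j) ∈ S) ∨
      ((Mode.cancel, j, l) ∈ S ∧ (Mode.meet, i, l) ∈ S) ∨
      ∃ a, w[i]? = some (some a) ∧ w[j]? = some (some a) ∧ (Mode.meet, i + 1, j + 1) ∈ S := by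
  have h := lt_of_subset_facts hS
  simp only [Reg.Derives, gathered, Reg.setSym, Reg.setEntry, Function.update]
  simp only [Fin.isValue, Fin.reduceEq, dite_false, dite_true, lookup_eq_true_iff hj h,
    lookup_eq_true_iff hl h]
  refine or_congr_right (or_congr_right (or_congr_right (exists_congr fun a =>
    and_congr_right fun _ => and_congr_right fun h' => ?_)))
  exact lookup_eq_true_iff (hw _ _ h') h

theorem derives_gathered_differ (hS : S ⊆ facts w)
    (hw : ∀ p a, w[p]? = some (some a) → p + 1 < w.length)
    (v : Reg A) : (gathered w S i j l v).Derives .differ ↔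
      w[i]? ≠ w[j]? ∨
      ∃ a, w[i]? = some (some a) ∧ w[j]? = some (some a) ∧ (Mode.differ, i + 1, j + 1) ∈ S := by
  have h := lt_of_subset_facts hS
  simp only [Reg.Derives, gathered, Reg.setSym, Reg.setEntry, Function.update]
  simp only [Fin.isValue, Fin.reduceEq, dite_false, dite_true]
  refine or_congr_right (exists_congr fun a =>
    and_congr_right fun _ => and_congr_right fun h' => ?_)
  exact lookup_eq_true_iff (hw _ _ h') h

theorem extend_subset_facts (hw : ∀ p a, w[p]? = some (some a) → p + 1 < w.length)
    (hi : i < w.length) (hj : j < w.length) (hl : l < w.length) (hS : S ⊆ facts w) :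
    extend w i j l S ⊆ facts w := by
  rintro ⟨m, a, b⟩ ((h | ⟨e, v, hv⟩) | h)
  · exact hS h
  · obtain ⟨rfl, rfl⟩ : a = i ∧ b = j := by simpa using e
    change Fact w m a b
    cases m with
    | cancel =>
      rw [derives_gathered_cancel hS hj hl] at hv
      rcases hv with ⟨h₁, h₂, h₃⟩ | ⟨x, c, h₁, h₂, h₃, h₄⟩
      · exact .eps h₁ h₂ (hS h₃)
      · exact .bracket h₁ h₂ (hS h₃) (hS h₄)
    | meet =>
      rw [derives_gathered_meet hS hw hj hl] at hv
      rcases hv with ⟨h₁, h₂⟩ | ⟨h₁, h₂⟩ | ⟨h₁, h₂⟩ | ⟨c, h₁, h₂, h₃⟩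
      · exact .ends h₁ h₂
      · exact .left (hS h₁) (hS h₂)
      · exact .right (hS h₁) (hS h₂)
      · exact .both h₁ h₂ (hS h₃)
    | differ =>
      rw [derives_gathered_differ hS hw] at hv
      rcases hv with h | ⟨c, h₁, h₂, h₃⟩
      · exact .differ hi hj h
      · exact .same h₁ h₂ (hS h₃)
  · rw [Set.mem_singleton_iff] at h
    obtain ⟨rfl, rfl, rfl⟩ : m = .cancel ∧ a = i ∧ b = i := by simpa using h
    exact Fact.refl hi

theorem saturate_subset_facts (hw : ∀ p a, w[p]? = some (some a) → p + 1 < w.length)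
    (hS : S ⊆ facts w) : saturate w S ⊆ facts w :=
  iter_induction (P := fun S => S ⊆ facts w) (fun _ hi _ h =>
    iter_induction (P := fun S => S ⊆ facts w) (fun _ hj _ h =>
      iter_induction (P := fun S => S ⊆ facts w) (fun _ hl _ h =>
        extend_subset_facts hw hi hj hl h) h) h) hS

/-- A set fixed by a whole round is fixed by each single `extend`, hence closed under all the rules
that generate `Fact`. -/
theorem eq_facts_of_saturate_eq (hw : ∀ p a, w[p]? = some (some a) → p + 1 < w.length)
    (hS : S ⊆ facts w) (h : saturate w S = S) : S = facts w := by
  have hext : ∀ {i j l}, i < w.length → j < w.length → l < w.length → extend w i j l S = S := by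
    intro i j l hi hj hl
    have h₁ := eq_of_iter_eq (fun _ => subset_iter (fun _ => subset_iter (fun _ =>
      subset_extend _ _ _) _) _) h hi
    have h₂ := eq_of_iter_eq (fun _ => subset_iter (fun _ => subset_extend _ _ _) _) h₁ hj
    exact eq_of_iter_eq (fun _ => subset_extend _ _ _) h₂ hl
  have hadd : ∀ {m i j l}, i < w.length → j < w.length → l < w.length →
      (∀ v : Reg A, (gathered w S i j l v).Derives m) → (m, i, j) ∈ S := by
    intro m i j l hi hj hl hv
    rw [← hext hi hj hl]
    exact .inl (.inr ⟨rfl, ⟨⟨fun _ => none, fun _ _ => false, false⟩, hv _⟩⟩)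
  have lt_of : ∀ {p : ℕ} {a}, w[p]? = some a → p < w.length :=
    fun h => (List.getElem?_eq_some_iff.1 h).1
  refine hS.antisymm ?_
  rintro ⟨m, p, q⟩ hf
  change Fact w m p q at hf
  induction hf with
  | @refl p hp =>
    rw [← hext hp hp hp]
    exact .inr rfl
  | @eps p r q h₁ h₂ h₃ ih =>
    exact hadd (lt_of h₁) h₃.lt.2 h₂.1 fun v =>
      (derives_gathered_cancel hS h₃.lt.2 h₂.1 v).2 (.inl ⟨h₁, h₂, ih⟩)
  | @bracket p r q x b h₁ h₂ h₃ h₄ ih₁ ih₂ =>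
    exact hadd (lt_of h₁) h₄.lt.2 (lt_of h₂) fun v =>
      (derives_gathered_cancel hS h₄.lt.2 (lt_of h₂) v).2 (.inr ⟨x, b, h₁, h₂, ih₁, ih₂⟩)
  -- This rule involves no third cell, so `q` is taken as an arbitrary valid one; likewise for
  -- `both`, `differ` and `same`.
  | @ends p q h₁ h₂ =>
    exact hadd (lt_of h₁) (lt_of h₂) (lt_of h₂) fun v =>
      (derives_gathered_meet hS hw (lt_of h₂) (lt_of h₂) v).2 (.inl ⟨h₁, h₂⟩)
  | @left p r q h₁ h₂ ih₁ ih₂ =>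
    exact hadd h₁.lt.1 h₂.lt.2 h₁.lt.2 fun v =>
      (derives_gathered_meet hS hw h₂.lt.2 h₁.lt.2 v).2 (.inr (.inl ⟨ih₁, ih₂⟩))
  | @right p r q h₁ h₂ ih₁ ih₂ =>
    exact hadd h₂.lt.1 h₁.lt.1 h₁.lt.2 fun v =>
      (derives_gathered_meet hS hw h₁.lt.1 h₁.lt.2 v).2 (.inr (.inr (.inl ⟨ih₁, ih₂⟩)))
  | @both p q a h₁ h₂ h₃ ih =>
    exact hadd (lt_of h₁) (lt_of h₂) (lt_of h₂) fun v =>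
      (derives_gathered_meet hS hw (lt_of h₂) (lt_of h₂) v).2 (.inr (.inr (.inr ⟨a, h₁, h₂, ih⟩)))
  | @differ p q hp hq h =>
    exact hadd hp hq hq fun v => (derives_gathered_differ hS hw v).2 (.inl h)
  | @same p q a h₁ h₂ h₃ ih =>
    exact hadd (lt_of h₁) (lt_of h₂) (lt_of h₂) fun v =>
      (derives_gathered_differ hS hw v).2 (.inr ⟨a, h₁, h₂, ih⟩)

theorem iterate_saturate_eq_facts (hw : ∀ p a, w[p]? = some (some a) → p + 1 < w.length) {N : ℕ}
    (hN : 3 * (w.length * w.length) ≤ N) : (saturate w)^[N] ∅ = facts w := by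
  have hsub : ∀ k, (saturate w)^[k] ∅ ⊆ facts w := by
    intro k
    induction k with
    | zero => exact Set.empty_subset _
    | succ k ih =>
      rw [Function.iterate_succ_apply']
      exact saturate_subset_facts hw ih
  exact eq_facts_of_saturate_eq hw (hsub N) (iterate_isFixedPt_of_card_le subset_saturate finite_facts
    (fun _ => saturate_subset_facts hw) (Set.empty_subset _) (ncard_facts_le.trans hN))

end Closure

end Saturation

/-! ### The decision procedure as a program -/

/-- The tapes of the decision procedure: the input, three copies of it that serve as pointers to
cells, the table, and the output. -/
inductive Tp
  | inp
  | ptr (x : Fin 3)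
  | tab
  | out
  deriving DecidableEq

instance : Fintype Tp :=
  ⟨{.inp, .ptr 0, .ptr 1, .ptr 2, .tab, .out}, fun k => by
    rcases k with _ | x | _ | _
    · simp
    · fin_cases x <;> simp
    · simp
    · simp⟩

/-- The alphabets of the tapes. -/
@[reducible]
def TpΓ (A : Type) : Tp → Type
  | .inp => Option (A × Bool)
  | .ptr _ => Option (A × Bool)
  | .tab => Entry
  | .out => Bool

instance (A : Type) : ∀ k, Inhabited (TpΓ A k)
  | .inp => ⟨none⟩
  | .ptr _ => ⟨none⟩
  | .tab => ⟨fun _ => false⟩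
  | .out => ⟨false⟩

section Procedure

variable {A : Type}

open Prog

local infixr:60 " ;; " => Prog.seq

variable (A) in
/-- The programs of the decision procedure. -/
abbrev Proc : Type := Prog (TpΓ A) (Reg A)

/-- Read the symbol at a pointer. -/
def readSym (i : Fin 4) (x : Fin 3) : Proc A := peek (.ptr x) true fun v a => v.setSym i a

/-- Read the symbol in front of a pointer. -/
def readPrev (i : Fin 4) (x : Fin 3) : Proc A := peek (.ptr x) false fun v a => v.setSym i a

/-- Move to the row and the column of the table given by two pointers. -/
def seek (x y : Fin 3) : Proc A :=
  loop .tab false (move .tab false) ;;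
  -- A table row is as long as the input, whose head rests at its right end; the inner loop thus
  -- skips one row.
  loop (.ptr x) false (loop .inp false (move .tab true)) ;;
  loop (.ptr y) false (move .tab true)

/-- Read the entry of the table given by two pointers. -/
def readEntry (i : Fin 6) (x y : Fin 3) : Proc A :=
  seek x y ;; peek .tab true fun v a => v.setEntry i (a.getD fun _ => false)

/-- Run a program with a pointer moved to the next cell. -/
def shifted (x : Fin 3) (p : Proc A) : Proc A :=
  move (.ptr x) true ;; p ;; move (.ptr x) false

/-- Run a program for all positions of a pointer. -/
def forPtr (x : Fin 3) (p : Proc A) : Proc A :=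
  loop (.ptr x) false (move (.ptr x) false) ;; loop .inp false (p ;; move (.ptr x) true)

/-- Repeat a program as many times as the input is long. -/
def forInp (p : Proc A) : Proc A := loop .inp false p

/-- Read what is needed to derive facts. -/
def gatherProg : Proc A :=
  readSym 0 0 ;; readSym 1 1 ;; readSym 2 2 ;; readPrev 3 2 ;;
  readEntry 0 0 2 ;; readEntry 1 1 2 ;; readEntry 2 2 1 ;;
  shifted 0 (readEntry 3 0 2) ;; shifted 0 (shifted 1 (readEntry 4 0 1)) ;;
  shifted 2 (readEntry 5 2 1)

open Classical in
/-- Add the derived facts to the table. -/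
noncomputable def extendProg : Proc A :=
  gatherProg ;;
  seek 0 1 ;; modify .tab true (fun v e m => e m || decide (v.Derives m)) ;;
  seek 0 0 ;; modify .tab true (fun _ e m => e m || decide (m = .cancel))

/-- One round of the saturation of the table. -/
noncomputable def saturateProg : Proc A := forPtr 0 (forPtr 1 (forPtr 2 extendProg))

/-- The register exhibits a violation of the code property. The symbols are those in front of `p`,
in front of `q` and at `q`, and the entry that at `(p, q)`. -/
def Reg.Violates (v : Reg A) : Prop :=
  (v.sym 0 = none ∨ v.sym 0 = some none) ∧
    ((v.sym 2 = some none ∧ v.entry 0 .cancel = true) ∨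
      ((v.sym 1 = none ∨ v.sym 1 = some none) ∧ v.entry 0 .meet = true ∧
        v.entry 0 .differ = true))

open Classical in
/-- Look for a violation of the code property. -/
noncomputable def inspectProg : Proc A :=
  readPrev 0 0 ;; readPrev 1 1 ;; readSym 2 1 ;; readEntry 0 0 1 ;;
  load fun v => { v with acc := v.acc || decide v.Violates }

/-- Copy the input to the pointers and make an empty table. -/
def initProg : Proc A :=
  loop .inp true (peek .inp true (fun v a => v.setSym 0 a) ;;
    push (.ptr 0) false (fun v => (v.sym 0).getD none) ;;
    push (.ptr 1) false (fun v => (v.sym 0).getD none) ;;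
    push (.ptr 2) false (fun v => (v.sym 0).getD none) ;; move .inp true) ;;
  forInp (forInp (push .tab false fun _ _ => false))

/-- Remove the contents of a pointer. -/
def clearPtr (x : Fin 3) : Proc A :=
  forInp (move (.ptr x) true) ;; loop (.ptr x) false (pop (.ptr x) false)

/-- Write the answer and remove the contents of the other tapes. -/
def finishProg : Proc A :=
  clearPtr 0 ;; clearPtr 1 ;; clearPtr 2 ;;
  forInp (forInp (move .tab true)) ;; loop .tab false (pop .tab false) ;;
  loop .inp false (pop .inp false) ;; push .out false (fun v => !v.acc)

/-- The part of the procedure after the initialization. -/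
noncomputable def mainProg : Proc A :=
  -- Three rounds inside two loops over the input make 3n² rounds, one for each possible fact.
  forInp (forInp (saturateProg ;; saturateProg ;; saturateProg)) ;;
  forPtr 0 (forPtr 1 inspectProg) ;; finishProg

/-! #### The effect of the procedure -/

variable (w : List (Option (A × Bool)))

/-- The contents of the tapes when the table holds the facts in `S`. -/
noncomputable def contents (S : Set (Mode × ℕ × ℕ)) : ∀ k, List (TpΓ A k)
  | .inp => w
  | .ptr _ => w
  | .tab => table w.length S
  | .out => []

/-- The positions of the heads. -/
def heads (n : ℕ) (pos : Fin 3 → ℕ) (t : ℕ) : Tp → ℕ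
  | .inp => n
  | .ptr x => pos x
  | .tab => t
  | .out => 0

/-- The register is `v`, the pointers are at `pos`, and the table holds the facts in `S`. -/
def At (pos : Fin 3 → ℕ) (S : Set (Mode × ℕ × ℕ)) (v : Reg A) (s : Store (TpΓ A) (Reg A)) : Prop :=
  (∀ x, pos x ≤ w.length) ∧ ∃ t, s = tapes v (contents w S) (heads w.length pos t)

theorem update_heads_ptr (n : ℕ) (pos : Fin 3 → ℕ) (t : ℕ) (x : Fin 3) (i : ℕ) :
    Function.update (heads n pos t) (.ptr x) i = heads n (Function.update pos x i) t := by
  funext k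
  rcases k with _ | y | _ | _
  · rfl
  · by_cases h : y = x
    · subst h
      simp [heads]
    · simp [heads, h]
  · rfl
  · rfl

theorem update_heads_tab (n : ℕ) (pos : Fin 3 → ℕ) (t i : ℕ) :
    Function.update (heads n pos t) .tab i = heads n pos i := by
  funext k
  rcases k with _ | y | _ | _ <;> simp [heads]

theorem update_contents_tab (S S' : Set (Mode × ℕ × ℕ)) :
    Function.update (contents w S) .tab (table w.length S') = contents w S' := by
  funext k
  rcases k with _ | y | _ | _ <;> simp [contents]

variable {w} {pos : Fin 3 → ℕ} {S : Set (Mode × ℕ × ℕ)} {v : Reg A} {s : Store (TpΓ A) (Reg A)}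

theorem At.move_true (h : At w pos S v s) {x : Fin 3} (hx : pos x < w.length) :
    At w (Function.update pos x (pos x + 1)) S v (sem (move (.ptr x) true) s) := by
  obtain ⟨h, t, rfl⟩ := h
  refine ⟨fun y => ?_, t, ?_⟩
  · by_cases hy : y = x
    · subst hy
      simpa using hx
    · simpa [hy] using h y
  · rw [sem_move_true, update_heads_ptr]
    rfl

theorem At.move_false (h : At w pos S v s) (x : Fin 3) :
    At w (Function.update pos x (pos x - 1)) S v (sem (move (.ptr x) false) s) := by
  obtain ⟨h, t, rfl⟩ := h
  refine ⟨fun y => ?_, t, ?_⟩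
  · by_cases hy : y = x
    · subst hy
      have := h y
      simp
      omega
    · simpa [hy] using h y
  · rw [sem_move_false _ _ _ (h x), update_heads_ptr]
    rfl

theorem At.rewind (h : At w pos S v s) (x : Fin 3) :
    At w (Function.update pos x 0) S v (sem (loop (.ptr x) false (move (.ptr x) false)) s) := by
  obtain ⟨h, t, rfl⟩ := h
  refine ⟨fun y => ?_, t, ?_⟩
  · by_cases hy : y = x
    · subst hy
      simp
    · simpa [hy] using h y
  · rw [sem_rewind, update_heads_ptr]

/-- At the right end the move forward would have no effect, and the move back would leave the
pointer one cell too far left; `hx` excludes this. -/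
theorem At.sem_shifted {p : Proc A} {x : Fin 3} {v' : Reg A} (hx : pos x < w.length)
    (hp : ∀ s, At w (Function.update pos x (pos x + 1)) S v s →
      At w (Function.update pos x (pos x + 1)) S v' (sem p s)) (h : At w pos S v s) :
    At w pos S v' (sem (shifted x p) s) := by
  have := (hp _ (h.move_true hx)).move_false x
  rwa [Function.update_idem, Function.update_self, Nat.add_sub_cancel,
    Function.update_eq_self] at this

theorem At.sem_readSym (h : At w pos S v s) (i : Fin 4) (x : Fin 3) :
    At w pos S (v.setSym i w[pos x]?) (sem (readSym i x) s) := by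
  obtain ⟨h, t, rfl⟩ := h
  exact ⟨h, t, by rw [readSym, sem_peek_true]; rfl⟩

theorem At.sem_readPrev (h : At w pos S v s) (i : Fin 4) (x : Fin 3) :
    At w pos S (v.setSym i (w.take (pos x)).reverse.head?) (sem (readPrev i x) s) := by
  obtain ⟨h, t, rfl⟩ := h
  exact ⟨h, t, by rw [readPrev, sem_peek_false]; rfl⟩

theorem sem_loop_inp_move_tab (c : ∀ k, List (TpΓ A k)) (pos : Tp → ℕ) (hc : c .inp = w)
    (hpos : pos .inp = w.length) : sem (loop .inp false (move .tab true)) (tapes v c pos) =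
      tapes v c (Function.update pos .tab (pos .tab + w.length)) := by
  rw [sem_loop_false, iterate_sem_move_true, hc, hpos, min_self]

theorem iterate_loop_inp_move_tab (c : ∀ k, List (TpΓ A k)) (pos : Tp → ℕ) (hc : c .inp = w)
    (hpos : pos .inp = w.length) (m : ℕ) :
    (sem (loop .inp false (move .tab true)))^[m] (tapes v c pos) =
      tapes v c (Function.update pos .tab (pos .tab + m * w.length)) := by
  induction m with
  | zero => simp
  | succ m ih =>
    rw [Function.iterate_succ_apply', ih, sem_loop_inp_move_tab c _ hc (by simpa using hpos),
      Function.update_idem, Function.update_self, add_assoc, Nat.succ_mul]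

theorem sem_seek (h : ∀ x, pos x ≤ w.length) (x y : Fin 3) (t : ℕ) :
    sem (seek x y) (tapes v (contents w S) (heads w.length pos t)) =
      tapes v (contents w S) (heads w.length pos (pos x * w.length + pos y)) := by
  rw [seek, sem_seq, sem_seq, sem_rewind, update_heads_tab]
  rw [sem_loop_false, iterate_loop_inp_move_tab (w := w) _ _ rfl rfl, update_heads_tab,
    sem_loop_false, iterate_sem_move_true, update_heads_tab]
  have hx : min (pos x) w.length = pos x := min_eq_left (h x)
  have hy : min (pos y) w.length = pos y := min_eq_left (h y)
  simp [heads, contents, hx, hy]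

theorem At.sem_readEntry (h : At w pos S v s) (i : Fin 6) (x y : Fin 3) :
    At w pos S (v.setEntry i (lookup w.length S (pos x) (pos y))) (sem (readEntry i x y) s) := by
  obtain ⟨h, t, rfl⟩ := h
  exact ⟨h, _, by rw [readEntry, sem_seq, sem_seek h, sem_peek_true]; rfl⟩

theorem At.sem_load (h : At w pos S v s) (f : Reg A → Reg A) :
    At w pos S (f v) (sem (load f) s) := by
  obtain ⟨h, t, rfl⟩ := h
  exact ⟨h, t, rfl⟩

open Classical in
theorem getElem_table {n x : ℕ} (S : Set (Mode × ℕ × ℕ)) (h : x < (table n S).length) :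
    (table n S)[x] = fun m => decide ((m, x / n, x % n) ∈ S) :=
  (List.getElem_map _).trans (by rw [List.getElem_range])

open Classical in
theorem modify_table {n i j : ℕ} (hi : i < n) (hj : j < n) (S : Set (Mode × ℕ × ℕ))
    (P : Mode → Prop) :
    (table n S).modify (i * n + j) (fun e m => e m || decide (P m)) =
      table n {t | t ∈ S ∨ t.2 = (i, j) ∧ P t.1} := by
  refine List.ext_getElem (by simp [length_table]) fun x h₁ h₂ => ?_
  rw [length_table] at h₂
  rw [List.getElem_modify, getElem_table, getElem_table]
  have hdm : i * n + j = x ↔ x / n = i ∧ x % n = j := by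
    constructor
    · rintro rfl
      rw [mul_comm, Nat.mul_add_div (by omega), Nat.div_eq_of_lt hj, Nat.mul_add_mod,
        Nat.mod_eq_of_lt hj]
      simp
    · rintro ⟨rfl, rfl⟩
      exact Nat.div_add_mod' x n
  split
  · next h =>
    funext m
    obtain ⟨h₃, h₄⟩ := hdm.1 h
    simp [h₃, h₄]
  · next h =>
    funext m
    have : ¬ (x / n = i ∧ x % n = j) := fun h' => h (hdm.2 h')
    simp [this]

open Classical in
theorem At.sem_modify (h : At w pos S v s) (x y : Fin 3) (hx : pos x < w.length)
    (hy : pos y < w.length) (P : Reg A → Mode → Prop) :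
    At w pos {t | t ∈ S ∨ t.2 = (pos x, pos y) ∧ P v t.1} v
      (sem (seek x y ;; modify .tab true fun v e m => e m || decide (P v m)) s) := by
  obtain ⟨h, t, rfl⟩ := h
  refine ⟨h, pos x * w.length + pos y, ?_⟩
  rw [sem_seq, sem_seek h, sem_modify_true, ← update_contents_tab w S {t | _ ∨ _}]
  congr 2
  exact modify_table hx hy S (P v)

theorem At.sem_gather (h : At w pos S v s) (hpos : ∀ x, pos x < w.length) :
    At w pos S (gathered w S (pos 0) (pos 1) (pos 2) v) (sem gatherProg s) := by
  have h₁ := (((((((h.sem_readSym 0 0).sem_readSym 1 1).sem_readSym 2 2).sem_readPrev 3 2).sem_readEntry 0 0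
    2).sem_readEntry 1 1 2).sem_readEntry 2 2 1)
  have h₂ := At.sem_shifted (p := readEntry 3 0 2) (hpos 0) (fun s hs => by
    simpa using hs.sem_readEntry 3 0 2) h₁
  have h₃ := At.sem_shifted (p := shifted 1 (readEntry 4 0 1)) (hpos 0) (fun s hs =>
    At.sem_shifted (p := readEntry 4 0 1) (x := 1) (by simpa using hpos 1) (fun s hs => by
      simpa using hs.sem_readEntry 4 0 1) hs) h₂
  rw [gathered, gatherProg]
  simp only [sem_seq]
  exact At.sem_shifted (p := readEntry 5 2 1) (hpos 2) (fun s hs => by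
    simpa using hs.sem_readEntry 5 2 1) h₃

theorem At.sem_extend (h : At w pos S v s) (hpos : ∀ x, pos x < w.length) :
    ∃ v', v'.acc = v.acc ∧ At w pos (extend w (pos 0) (pos 1) (pos 2) S) v' (sem extendProg s) := by
  refine ⟨gathered w S (pos 0) (pos 1) (pos 2) v, rfl, ?_⟩
  have h₁ := (h.sem_gather hpos).sem_modify 0 1 (hpos 0) (hpos 1) (fun v m => v.Derives m)
  have h₂ := h₁.sem_modify 0 0 (hpos 0) (hpos 0) (fun _ m => m = .cancel)
  rw [extendProg]
  simp only [sem_seq] at h₁ h₂ ⊢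
  convert h₂ using 1
  swap
  · congr!
  ext ⟨m, a, b⟩
  simp only [extend, Set.mem_union, Set.mem_ofPred_eq, Set.mem_singleton_iff,
    Prod.mk.injEq]
  refine or_congr (or_congr_right (and_congr_right fun _ => ⟨?_, fun h => ⟨v, h⟩⟩)) and_comm
  -- The program tests its actual register, which by `derives_gathered` decides the same as any
  -- other.
  rintro ⟨v', h'⟩
  rwa [derives_gathered w S _ _ _ v v']

/-! #### Loops -/

variable (w) in
/-- The pointers satisfy `P`, the table holds the facts in `d.1`, and the flag is `d.2`. -/
def Good (P : (Fin 3 → ℕ) → Prop) (d : Set (Mode × ℕ × ℕ) × Bool)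
    (s : Store (TpΓ A) (Reg A)) : Prop :=
  ∃ pos v, P pos ∧ v.acc = d.2 ∧ At w pos d.1 v s

variable {P : (Fin 3 → ℕ) → Prop} {d : Set (Mode × ℕ × ℕ) × Bool}

theorem length_inp_of_at (h : At w pos S v s) : (s.stk (.inp, false)).length = w.length := by
  obtain ⟨-, t, rfl⟩ := h
  simp [tapes, zipper, contents, heads]

/-- In nested loops `P` records the positions fixed by the outer loops; `hP` says that it leaves the
pointer `x` free. -/
theorem Good.sem_forPtr {p : Proc A} {x : Fin 3}
    {f : ℕ → Set (Mode × ℕ × ℕ) × Bool → Set (Mode × ℕ × ℕ) × Bool}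
    (hP : ∀ pos i, P pos → P (Function.update pos x i))
    (hp : ∀ i < w.length, ∀ d s, Good w (fun pos => P pos ∧ pos x = i) d s →
      Good w (fun pos => P pos ∧ pos x = i) (f i d) (sem p s))
    (h : Good w P d s) : Good w P (iter f w.length d) (sem (forPtr x p) s) := by
  obtain ⟨pos, v, h₁, h₂, h₃⟩ := h
  have h₄ := h₃.rewind x
  rw [forPtr, sem_seq]
  generalize sem (loop (.ptr x) false (move (.ptr x) false)) s = s₀ at h₄
  rw [sem, length_inp_of_at h₄]
  have main : ∀ n ≤ w.length, Good w (fun pos => P pos ∧ pos x = n) (iter f n d)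
      ((sem (p ;; move (.ptr x) true))^[n] s₀) := by
    intro n
    induction n with
    | zero => exact fun _ => ⟨_, v, ⟨hP _ _ h₁, by simp⟩, h₂, h₄⟩
    | succ n ih =>
      intro hn
      rw [Function.iterate_succ_apply', sem_seq]
      obtain ⟨pos', v', ⟨h₅, h₆⟩, h₇, h₈⟩ := hp n hn _ _ (ih (by omega))
      exact ⟨_, v', ⟨hP _ _ h₅, by simp [h₆]⟩, h₇, h₈.move_true (by omega)⟩
  obtain ⟨pos', v', ⟨h₅, -⟩, h₆⟩ := main _ le_rfl
  exact ⟨pos', v', h₅, h₆⟩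

theorem Good.sem_forInp {p : Proc A} {f : Set (Mode × ℕ × ℕ) × Bool → Set (Mode × ℕ × ℕ) × Bool}
    (hp : ∀ d s, Good w P d s → Good w P (f d) (sem p s)) (h : Good w P d s) :
    Good w P (f^[w.length] d) (sem (forInp p) s) := by
  have hlen : (s.stk (.inp, false)).length = w.length := by
    obtain ⟨pos, v, -, -, h⟩ := h
    exact length_inp_of_at h
  rw [forInp, sem, hlen]
  have main : ∀ n, Good w P (f^[n] d) ((sem p)^[n] s) := by
    intro n
    induction n with
    | zero => exact h
    | succ n ih =>
      rw [Function.iterate_succ_apply', Function.iterate_succ_apply']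
      exact hp _ _ ih
  exact main _

theorem iter_prod {α β : Type*} (f : ℕ → α → α) (n : ℕ) (a : α) (b : β) :
    iter (fun i (d : α × β) => (f i d.1, d.2)) n (a, b) = (iter f n a, b) := by
  induction n with
  | zero => rfl
  | succ n ih => rw [iter, ih]; rfl

theorem Good.sem_saturate (h : Good w (fun _ => True) d s) :
    Good w (fun _ => True) (saturate w d.1, d.2) (sem saturateProg s) := by
  have h₁ := h.sem_forPtr (x := 0) (p := forPtr 1 (forPtr 2 extendProg))
    (fun _ _ _ => trivial) (f := fun i d => (iter (fun j => iter (fun l => extend w i j l) w.length)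
      w.length d.1, d.2)) (fun i hi d s h => by
    have h₂ := h.sem_forPtr (x := 1) (p := forPtr 2 extendProg)
      (fun pos _ h => by simpa using h)
      (f := fun j d => (iter (fun l => extend w i j l) w.length d.1, d.2)) (fun j hj d s h => by
      have h₃ := h.sem_forPtr (x := 2) (p := extendProg) (fun pos _ h => by simpa using h)
        (f := fun l d => (extend w i j l d.1, d.2)) (fun l hl d s h => by
        obtain ⟨pos, v, ⟨⟨⟨-, h₀⟩, h₁⟩, h₂⟩, hv, h⟩ := h
        obtain ⟨v', hv', h'⟩ := h.sem_extend (by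
          intro x
          fin_cases x
          · exact h₀ ▸ hi
          · exact h₁ ▸ hj
          · exact h₂ ▸ hl)
        rw [h₀, h₁, h₂] at h'
        exact ⟨pos, v', ⟨⟨⟨trivial, h₀⟩, h₁⟩, h₂⟩, hv'.trans hv, h'⟩)
      rwa [iter_prod] at h₃)
    rwa [iter_prod] at h₂)
  rwa [iter_prod] at h₁

theorem Good.sem_iterate_saturate (h : Good w (fun _ => True) (∅, d.2) s)
    (hw : ∀ p a, w[p]? = some (some a) → p + 1 < w.length) :
    Good w (fun _ => True) (facts w, d.2)
      (sem (forInp (forInp (saturateProg ;; saturateProg ;; saturateProg))) s) := by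
  have hf : ∀ (m k : ℕ) (d : Set (Mode × ℕ × ℕ) × Bool),
      (fun d : Set (Mode × ℕ × ℕ) × Bool => ((saturate w)^[k] d.1, d.2))^[m] d =
        ((saturate w)^[k * m] d.1, d.2) := by
    intro m k d
    induction m with
    | zero => rfl
    | succ m ih =>
      rw [Function.iterate_succ_apply', ih, Nat.mul_succ, add_comm, Function.iterate_add_apply]
  have h₁ := h.sem_forInp (p := forInp (saturateProg ;; saturateProg ;; saturateProg))
    (f := fun d => ((saturate w)^[3 * w.length] d.1, d.2)) (fun d s h => by
    have h₂ := h.sem_forInp (p := saturateProg ;; saturateProg ;; saturateProg)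
      (f := fun d => ((saturate w)^[3] d.1, d.2)) (fun d s h =>
        h.sem_saturate.sem_saturate.sem_saturate)
    rwa [hf] at h₂)
  rwa [hf, iterate_saturate_eq_facts hw (by rw [mul_assoc])] at h₁

/-- According to the facts in `S`, the pair of cells `i` and `j` shows that the words do not form a
code. -/
def ViolationAt (w : List (Option (A × Bool))) (i j : ℕ) (S : Set (Mode × ℕ × ℕ)) : Prop :=
  IsStart w i ∧ ((w[j]? = some none ∧ lookup w.length S i j .cancel = true) ∨
    (IsStart w j ∧ lookup w.length S i j .meet = true ∧ lookup w.length S i j .differ = true))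

theorem violation_iff : Violation w ↔
    ∃ i < w.length, ∃ j < w.length, ViolationAt w i j (facts w) := by
  refine exists_congr fun i => and_congr_right fun _ => exists_congr fun j =>
    and_congr_right fun hj => ?_
  have hl : ∀ {m}, lookup w.length (facts w) i j m = true ↔ Fact w m i j :=
    lookup_eq_true_iff hj fun t ht => (Fact.lt ht).1
  rw [ViolationAt, hl, hl, hl]

open Classical in
theorem Good.sem_inspect {P : (Fin 3 → ℕ) → Prop} {i j : ℕ} (hi : i < w.length)
    (hj : j < w.length) (hP : ∀ pos, P pos → pos 0 = i ∧ pos 1 = j) (h : Good w P d s) :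
    Good w P (d.1, d.2 || decide (ViolationAt w i j d.1)) (sem inspectProg s) := by
  obtain ⟨pos, v, h₁, h₂, h₃⟩ := h
  obtain ⟨rfl, rfl⟩ := hP pos h₁
  have h₄ := ((((h₃.sem_readPrev 0 0).sem_readPrev 1 1).sem_readSym 2 1).sem_readEntry 0 0
    1).sem_load fun v => { v with acc := v.acc || decide v.Violates }
  rw [inspectProg]
  simp only [sem_seq]
  refine ⟨pos, _, h₁, ?_, h₄⟩
  simp only [Reg.setSym, Reg.setEntry, h₂]
  congr 2
  simp only [Reg.Violates, Function.update]
  simp only [Fin.isValue, Fin.reduceEq, dite_false, dite_true, ViolationAt, IsStart, hi, hj,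
    true_and]

/-- A loop that only accumulates a disjunction in the flag computes a bounded existential
quantifier. Applied to two nested loops, this yields the search over all pairs of cells. -/
theorem iter_flag {α : Type*} {f : ℕ → α × Bool → α × Bool} {E : ℕ → α → Prop} {n : ℕ}
    (h : ∀ i < n, ∀ d, (f i d).1 = d.1 ∧ ((f i d).2 = true ↔ d.2 = true ∨ E i d.1))
    (d : α × Bool) : (iter f n d).1 = d.1 ∧
      ((iter f n d).2 = true ↔ d.2 = true ∨ ∃ i < n, E i d.1) := by
  induction n with
  | zero => simp [iter]
  | succ n ih =>
    obtain ⟨h₁, h₂⟩ := ih fun i hi => h i (by omega)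
    obtain ⟨h₃, h₄⟩ := h n (by omega) (iter f n d)
    refine ⟨h₃.trans h₁, ?_⟩
    rw [iter, h₄, h₂, h₁, or_assoc]
    refine or_congr_right ⟨?_, ?_⟩
    · rintro (⟨i, hi, hE⟩ | hE)
      exacts [⟨i, by omega, hE⟩, ⟨n, by omega, hE⟩]
    · rintro ⟨i, hi, hE⟩
      rcases Nat.lt_succ_iff_lt_or_eq.1 hi with hi | rfl
      exacts [.inl ⟨i, hi, hE⟩, .inr hE]

theorem Good.sem_inspect_all (h : Good w (fun _ => True) (facts w, false) s) :
    ∃ b : Bool, (b = true ↔ Violation w) ∧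
      Good w (fun _ => True) (facts w, b) (sem (forPtr 0 (forPtr 1 inspectProg)) s) := by
  classical
  have h₁ := h.sem_forPtr (x := 0) (p := forPtr 1 inspectProg) (fun _ _ _ => trivial)
    (f := fun i => iter (fun j d => (d.1, d.2 || decide (ViolationAt w i j d.1))) w.length)
    (fun i hi d s h => h.sem_forPtr (x := 1) (p := inspectProg) (fun pos _ h => by simpa using h)
      (fun j hj d s h => h.sem_inspect hi hj fun pos hpos => ⟨hpos.1.2, hpos.2⟩))
  obtain ⟨h₂, h₃⟩ := iter_flag (n := w.length) (E := fun i S => ∃ j < w.length, ViolationAt w i j S)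
    (f := fun i => iter (fun j d => (d.1, d.2 || decide (ViolationAt w i j d.1))) w.length)
    (fun i _ d => iter_flag (E := fun j S => ViolationAt w i j S) (fun j _ d => by simp) d)
    (facts w, false)
  generalize iter _ _ _ = D at h₁ h₂ h₃
  obtain ⟨S, b⟩ := D
  obtain rfl : S = facts w := h₂
  exact ⟨b, by rw [h₃, violation_iff]; simp, h₁⟩

/-! #### The beginning and the end of the procedure -/

variable (w) in
/-- The contents of the tapes during the initialization. -/
def initContents (i m : ℕ) : ∀ k, List (TpΓ A k)
  | .inp => w
  | .ptr _ => w.take i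
  | .tab => List.replicate m fun _ => false
  | .out => []

/-- The positions of the heads during the initialization. -/
def initHeads (i m : ℕ) : Tp → ℕ
  | .inp => i
  | .ptr _ => i
  | .tab => m
  | .out => 0

theorem sem_init_ptr (v : Reg A) (i : ℕ) (hi : i < w.length) : ∃ v' : Reg A, v'.acc = v.acc ∧
    sem (peek .inp true (fun v a => v.setSym 0 a) ;;
      push (.ptr 0) false (fun v => (v.sym 0).getD none) ;;
      push (.ptr 1) false (fun v => (v.sym 0).getD none) ;;
      push (.ptr 2) false (fun v => (v.sym 0).getD none) ;; move .inp true : Proc A)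
      (tapes v (initContents w i 0) (initHeads i 0)) =
    tapes v' (initContents w (i + 1) 0) (initHeads (i + 1) 0) := by
  refine ⟨v.setSym 0 w[i]?, rfl, ?_⟩
  have htake : w.take (i + 1) = w.take i ++ [w[i]?.getD none] := by
    rw [List.take_add_one, List.getElem?_eq_getElem hi]
    rfl
  simp only [sem_seq]
  rw [sem_peek_true, sem_push_false _ _ _ _ (by simp [initHeads, initContents, hi.le]),
    sem_push_false _ _ _ _ (by simp [initHeads, initContents, hi.le]),
    sem_push_false _ _ _ _ (by simp [initHeads, initContents, hi.le]), sem_move_true]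
  congr 1
  · funext k
    rcases k with _ | x | _ | _
    · simp [initContents]
    · fin_cases x <;>
        simp [initContents, initHeads, Reg.setSym, htake]
    · simp [initContents]
    · simp [initContents]
  · funext k
    rcases k with _ | x | _ | _
    · simp [initHeads]
    · fin_cases x <;> simp [initHeads]
    · simp [initHeads]
    · simp [initHeads]

theorem sem_init_tab (v : Reg A) (i m : ℕ) : sem (push .tab false fun _ _ => false : Proc A)
    (tapes v (initContents w i m) (initHeads i m)) =
      tapes v (initContents w i (m + 1)) (initHeads i (m + 1)) := by
  rw [sem_push_false _ _ _ _ (by simp [initHeads, initContents])]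
  congr 1
  · funext k
    rcases k with _ | x | _ | _ <;> simp [initContents, List.replicate_succ']
  · funext k
    rcases k with _ | x | _ | _ <;> simp [initHeads]

theorem table_empty (n : ℕ) : table n ∅ = List.replicate (n * n) fun _ => false := by
  refine List.ext_getElem (by simp [length_table]) fun x h₁ h₂ => ?_
  rw [getElem_table, List.getElem_replicate]
  funext m
  simp

theorem good_init (v : Reg A) : Good w (fun _ => True) (∅, v.acc)
    (sem initProg ⟨v, oneStack .inp true w⟩) := by
  have h₀ : (⟨v, oneStack .inp true w⟩ : Store (TpΓ A) (Reg A)) =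
      tapes v (initContents w 0 0) (initHeads 0 0) := by
    ext1
    · rfl
    · funext ⟨k, b⟩
      rcases k with _ | x | _ | _ <;> cases b <;>
        simp [oneStack, tapes, zipper, initContents, initHeads]
  have h₁ : ∀ n ≤ w.length, ∃ v' : Reg A, v'.acc = v.acc ∧
      (sem (peek .inp true (fun v a => v.setSym 0 a) ;;
      push (.ptr 0) false (fun v => (v.sym 0).getD none) ;;
      push (.ptr 1) false (fun v => (v.sym 0).getD none) ;;
      push (.ptr 2) false (fun v => (v.sym 0).getD none) ;; move .inp true : Proc A))^[n]
      (tapes v (initContents w 0 0) (initHeads 0 0)) =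
        tapes v' (initContents w n 0) (initHeads n 0) := by
    intro n
    induction n with
    | zero => exact fun _ => ⟨v, rfl, rfl⟩
    | succ n ih =>
      intro hn
      obtain ⟨v', hv', e⟩ := ih (by omega)
      obtain ⟨v'', hv'', e'⟩ := sem_init_ptr v' n hn
      exact ⟨v'', hv''.trans hv', by rw [Function.iterate_succ_apply', e, e']⟩
  obtain ⟨v', hv', h₂⟩ := h₁ w.length le_rfl
  have h₃ : ∀ n m, (sem (push .tab false fun _ _ => false : Proc A))^[n]
      (tapes v' (initContents w w.length m) (initHeads w.length m)) =
        tapes v' (initContents w w.length (m + n)) (initHeads w.length (m + n)) := by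
    intro n m
    induction n with
    | zero => rfl
    | succ n ih => rw [Function.iterate_succ_apply', ih, sem_init_tab, add_assoc]
  have h₄ : ∀ m, sem (forInp (push .tab false fun _ _ => false) : Proc A)
      (tapes v' (initContents w w.length m) (initHeads w.length m)) =
        tapes v' (initContents w w.length (m + w.length)) (initHeads w.length (m + w.length)) := by
    intro m
    rw [forInp, sem_loop_false, h₃]
    simp [initHeads, initContents]
  have h₅ : ∀ n, (sem (forInp (push .tab false fun _ _ => false) : Proc A))^[n]
      (tapes v' (initContents w w.length 0) (initHeads w.length 0)) =
        tapes v' (initContents w w.length (n * w.length)) (initHeads w.length (n * w.length)) := by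
    intro n
    induction n with
    | zero => simp
    | succ n ih => rw [Function.iterate_succ_apply', ih, h₄, Nat.succ_mul]
  -- Copying leaves all pointers at their right ends, and the table head stands behind the n² empty
  -- entries.
  refine ⟨fun _ => w.length, v', trivial, hv', fun _ => le_rfl, w.length * w.length, ?_⟩
  rw [initProg, sem_seq, h₀, sem_loop_true]
  change sem (forInp _) ((sem _)^[w.length - 0] _) = _
  rw [Nat.sub_zero, h₂, forInp, sem_loop_false]
  have hmin : min (initHeads w.length 0 .inp) (initContents w w.length 0 .inp).length =
      w.length := by simp [initHeads, initContents]
  rw [hmin, h₅]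
  congr 1
  · funext k
    rcases k with _ | x | _ | _ <;> simp [initContents, contents, table_empty]

/-- Wherever the head is, `w.length` moves to the right bring it to the end, so that the whole tape
lies on the left stack and can be popped. -/
theorem sem_clearPtr (x : Fin 3) (c : ∀ k, List (TpΓ A k)) (pos : Tp → ℕ)
    (hpos : pos .inp = w.length) (hc : c .inp = w) (hx : (c (.ptr x)).length ≤ w.length) :
    sem (clearPtr x) (tapes v c pos) = tapes v (Function.update c (.ptr x) [])
      (Function.update pos (.ptr x) (pos (.ptr x) + w.length)) := by
  rw [clearPtr, sem_seq, forInp, sem_loop_false, iterate_sem_move_true, hpos, hc, min_self,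
    sem_clear]
  simp [hx.trans (Nat.le_add_left _ _)]

theorem sem_finish {P : (Fin 3 → ℕ) → Prop} (h : Good w P d s) :
    (sem finishProg s).stk = oneStack .out false [!d.2] := by
  obtain ⟨pos, v, -, hv, -, t, rfl⟩ := h
  rw [finishProg]
  simp only [sem_seq]
  rw [sem_clearPtr 0 _ _ rfl rfl le_rfl, sem_clearPtr 1 _ _ rfl rfl le_rfl,
    sem_clearPtr 2 _ _ rfl rfl le_rfl, forInp, forInp, sem_loop_false,
    iterate_loop_inp_move_tab (w := w) _ _ rfl rfl, sem_clear, sem_clear, sem_push_false]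
  · funext ⟨k, b⟩
    rcases k with _ | x | _ | _
    · cases b <;> simp [oneStack, tapes, zipper]
    · fin_cases x <;> cases b <;> simp [oneStack, tapes, zipper]
    · cases b <;> simp [oneStack, tapes, zipper]
    · cases b <;> simp [oneStack, tapes, zipper, contents, heads, hv]
  · rfl
  · exact le_rfl
  · simp [contents, heads, length_table]

theorem sem_mainProg {v : Reg A} (hv : v.acc = false)
    (hw : ∀ p a, w[p]? = some (some a) → p + 1 < w.length) :
    ∃ b : Bool, (b = true ↔ ¬ Violation w) ∧
      (sem (initProg ;; mainProg) ⟨v, oneStack .inp true w⟩).stk = oneStack .out false [b] := by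
  have h₁ := good_init (w := w) v
  rw [hv] at h₁
  obtain ⟨b, hb, h₂⟩ := (Good.sem_iterate_saturate (d := (∅, false)) h₁ hw).sem_inspect_all
  refine ⟨!b, by rw [← hb]; simp, ?_⟩
  rw [mainProg, sem_seq, sem_seq, sem_seq]
  exact sem_finish h₂

/-! #### The running time of the procedure -/

/-- The procedure is bounded in two pieces: the initialization pushes on the pointers and the table
but loops only over the input, while the main part loops over all these tapes and pushes only on the
output. -/
theorem bounded_initProg : Bounded (· = Tp.inp) (initProg : Proc A) := by
  simp [initProg, forInp, Bounded]

theorem bounded_mainProg : Bounded (· ≠ Tp.out) (mainProg : Proc A) := by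
  simp [mainProg, forInp, forPtr, Bounded, saturateProg, extendProg, inspectProg, finishProg,
    clearPtr, gatherProg, readSym, readPrev, readEntry, seek, shifted]

theorem size_init_le (v : Reg A) (k : Tp) :
    size (sem initProg ⟨v, oneStack .inp true w⟩) k ≤ w.length + w.length * w.length := by
  obtain ⟨pos, v', -, -, -, t, h⟩ := good_init (w := w) v
  rw [h]
  rcases k with _ | x | _ | _ <;> simp [size_tapes, contents, length_table]

/-- The main part starts on tapes of size at most n + n², so its bound is composed with this
polynomial. -/
theorem cost_le (v : Reg A) : cost (initProg ;; mainProg) ⟨v, oneStack .inp true w⟩ ≤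
    (bound (initProg : Proc A) + (bound (mainProg : Proc A)).comp
      (Polynomial.X + Polynomial.X * Polynomial.X)).eval w.length := by
  rw [Polynomial.eval_add, Polynomial.eval_comp, cost]
  refine add_le_add (bounded_initProg.cost_le _ ?_) (bounded_mainProg.cost_le _ fun k _ => ?_)
  · rintro k rfl
    simp [size, oneStack]
  · simpa using size_init_le v k

end Procedure

noncomputable instance (A : Type) [Finite A] : ∀ k, Fintype (TpΓ A k)
  | .inp => Fintype.ofFinite (Option (A × Bool))
  | .ptr _ => Fintype.ofFinite (Option (A × Bool))
  | .tab => Fintype.ofFinite Entry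
  | .out => inferInstanceAs (Fintype Bool)

instance (A : Type) [Finite A] : Finite (Reg A) :=
  Finite.of_injective (fun v : Reg A => (v.sym, v.entry, v.acc)) fun v v' h => by
    simp only [Prod.mk.injEq] at h
    exact Reg.ext h.1 h.2.1 h.2.2

open Prog in
theorem freenessDecidableInPolyTime_freeGroup (A : Type) [Finite A] [DecidableEq A] :
    FreenessDecidableInPolyTime (FreeGroup A) (freeGroupEncoding A) := by
  classical
  have := Fintype.ofFinite (Reg A)
  refine nonempty_computableInPolyTime (Γ := TpΓ A) (σ := Reg A) (inp := .inp) (out := .out)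
    (freeGroupEncoding A).encode Computability.encodeBool _
    (.seq initProg mainProg) ⟨fun _ => none, fun _ _ => false, false⟩
    (bound (initProg : Proc A) + (bound (mainProg : Proc A)).comp
      (Polynomial.X + Polynomial.X * Polynomial.X)) fun L => ⟨?_, ?_⟩
  · exact cost_le _
  · have hw : ∀ p a, ((freeGroupEncoding A).encode L)[p]? = some (some a) →
        p + 1 < ((freeGroupEncoding A).encode L).length :=
      fun _ _ => succ_lt_length_of_getElem?_some
    obtain ⟨b, hb, h⟩ := sem_mainProg (v := ⟨fun _ => none, fun _ _ => false, false⟩) rfl hw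
    rw [h]
    congr 1
    rw [← isCode_iff_not_violation] at hb
    cases b <;> simp_all [Computability.encodeBool]

end Freeness

theorem mainTheorem7 (A : Type) [Finite A] [DecidableEq A] :
    Freeness.FreenessDecidableInPolyTime (FreeGroup A) (Freeness.freeGroupEncoding A) := by
  exact Freeness.freenessDecidableInPolyTime_freeGroup A
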